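/- For positive integers $n,p$ let $G_{n,p}=C_p\wr\mathfrak S_n$ be the colored permutation group: the set of pairs $(s,\sigma)$ with $s\in C_p^n$, $\sigma\in\mathfrak S_n$, with product $(t,\tau)(s,\sigma)=\big((t_{\sigma(i)}+s_i)_i,\ \tau\sigma\big)$. Identify $(s,\sigma)$ with the word $(s_1,\sigma(1))\cdots(s_n,\sigma(n))$ over $C_p\times\{1,\dots,n\}$, and let $$\mathbf B_1=\sum_{a\in C_p}(a,1)\,ш\,\big((0,2)(0,3)\cdots(0,n)\big)\in\mathbb R G_{n,p},$$ where $u\,ш\,v$ denotes the sum of all interleavings (shuffles) of the words $u$ and $v$. Then $\frac1{np}\mathbf B_1$ is a probability distribution on $G_{n,p}$ (the top to random shuffle), and $\left(\frac1{np}\mathbf B_1\right)^k$ is the distribution after $k$ shuffles. Let $U$ be the uniform distribution on $G_{n,p}$, and let $d_{TV}(P,Q)=\frac12\sum_{w\in G_{n,p}}|P_w-Q_w|$. Fix $p\ge1$ and let $n\to\infty$. **Theorem.** (1) There is a function $f$ (which may depend on $p$) such that for every $c>0$ we have $f(c)>0$ and, with $k=\lfloor n\log n+cn\rfloor$, $$d_{TV}\Big(\big(\tfrac1{np}\mathbf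 B_1\big)^k,U\Big)=f(c)+o(1),\qquad n\to\infty,$$ and moreover $f(c)\le e^{-c}+O(e^{-2c})$ as $c\to\infty$. (2) Let $(c_n)$ be a real sequence with $\log\{\log(np)\cdot\log n\}\le c_n$ for all sufficiently large $n$ and $c_n/\log n\to0$, and let $k=\lfloor n\log n-c_n n\rfloor$. Then for every $\delta>0$, $$d_{TV}\Big(\big(\tfrac1{np}\mathbf B_1\big)^k,U\Big)\ge 1-O\big(n^{-1/2+\delta}\big),\qquad n\to\infty.$$ (3) Consequently there is a cutoff at $n\log n$: with $k=\lfloor a\,n\log n\rfloor$, the distance $d_{TV}\big((\frac1{np}\mathbf B_1)^k,U\big)$ tends to $1$ for every fixed $0<a<1$ and to $0$ for every fixed $a>1$. -/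

import Mathlib

open Filter Topology

/-- The colored permutation group `C_p ≀ 𝔖_n`: pairs `(s, σ)` with `s ∈ C_p^n` and `σ ∈ 𝔖_n`. -/
@[ext]
structure ColoredPerm (n p : ℕ) where
  color : Fin n → ZMod p
  perm : Equiv.Perm (Fin n)

namespace ColoredPerm

variable {n p : ℕ}

/-- `(t, τ)(s, σ) = (σt + s, τσ)` where `(σt)_i = t_{σ(i)}`. -/
instance : Mul (ColoredPerm n p) where
  mul a b := ⟨fun i => a.color (b.perm i) + b.color i, a.perm * b.perm⟩

instance : One (ColoredPerm n p) where
  one := ⟨0, 1⟩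

instance : Inv (ColoredPerm n p) where
  inv a := ⟨fun i => -a.color (a.perm⁻¹ i), a.perm⁻¹⟩

@[simp] theorem mul_color (a b : ColoredPerm n p) (i : Fin n) :
    (a * b).color i = a.color (b.perm i) + b.color i := rfl
@[simp] theorem mul_perm (a b : ColoredPerm n p) : (a * b).perm = a.perm * b.perm := rfl
@[simp] theorem one_color : (1 : ColoredPerm n p).color = 0 := rfl
@[simp] theorem one_perm : (1 : ColoredPerm n p).perm = 1 := rfl
@[simp] theorem inv_color (a : ColoredPerm n p) (i : Fin n) :
    (a⁻¹).color i = -a.color (a.perm⁻¹ i) := rfl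
@[simp] theorem inv_perm (a : ColoredPerm n p) : (a⁻¹).perm = a.perm⁻¹ := rfl

instance : Group (ColoredPerm n p) :=
  Group.ofLeftAxioms
    (fun a b c => by ext i <;> simp [add_assoc])
    (fun a => by ext i <;> simp)
    (fun a => by ext i <;> simp)

/-- A colored permutation is a pair of a coloring and a permutation. -/
def equivProd (n p : ℕ) : ColoredPerm n p ≃ (Fin n → ZMod p) × Equiv.Perm (Fin n) where
  toFun a := (a.color, a.perm)
  invFun a := ⟨a.1, a.2⟩
  left_inv _ := rfl
  right_inv _ := rfl

instance [NeZero p] : Fintype (ColoredPerm n p) := Fintype.ofEquiv _ (equivProd n p).symm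

/-- The word `(s_1, σ(1)) (s_2, σ(2)) ⋯ (s_n, σ(n))` of a colored permutation. The letters have
labels in `{1, …, n}`, written as natural numbers so that words of different sizes share
one alphabet. -/
def word (a : ColoredPerm n p) : List (ZMod p × ℕ) :=
  List.ofFn fun i => (a.color i, (a.perm i : ℕ) + 1)

end ColoredPerm

/-- The shuffle of two words: the multiset of all interleavings of `u` and `v`. -/
def wordShuffle {α : Type*} : List α → List α → Multiset (List α)
  | [], v => {v}
  | a :: u, [] => {a :: u}
  | a :: u, b :: v =>
      (wordShuffle u (b :: v)).map (a :: ·) + (wordShuffle (a :: u) v).map (b :: ·)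
  termination_by u v => u.length + v.length

/-- The word `W_{k,n} = (0,k+1) (0,k+2) ⋯ (0,n)`. -/
def tailWord (k n p : ℕ) : List (ZMod p × ℕ) :=
  (List.range' (k + 1) (n - k)).map fun j => (0, j)

/-- The element `B_k = ∑_{α ∈ G_{k,p}} α ⧢ W_{k,n}` of the group algebra of `G_{n,p}`
(for `0 ≤ k ≤ n`), a sum of words being read as a sum of the corresponding group elements.
For `k = 0` it is the identity, for `k = n` it is the sum of all group elements. -/
noncomputable def shuffleElement (n p k : ℕ) [NeZero p] : MonoidAlgebra ℝ (ColoredPerm n p) :=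
  ∑ g : ColoredPerm n p, MonoidAlgebra.single g
    (∑ α : ColoredPerm k p, ((wordShuffle α.word (tailWord k n p)).count g.word : ℝ))

/-- The top to random shuffle `(1/(np)) B_1` over `G_{n,p}`, as an element of the group algebra. -/
noncomputable def topToRandom (n p : ℕ) [NeZero p] : MonoidAlgebra ℝ (ColoredPerm n p) :=
  (1 / ((n : ℝ) * (p : ℝ))) • shuffleElement n p 1

/-- The uniform distribution `U` on `G_{n,p}`, a group of order `p^n n!`. -/
noncomputable def uniformDist (n p : ℕ) [NeZero p] : MonoidAlgebra ℝ (ColoredPerm n p) :=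
  ∑ g : ColoredPerm n p, MonoidAlgebra.single g (1 / ((p : ℝ) ^ n * (n.factorial : ℝ)))

/-- The total variation distance `½ ∑_w |P_w - Q_w|`. -/
noncomputable def tvDist {n p : ℕ} [NeZero p] (P Q : MonoidAlgebra ℝ (ColoredPerm n p)) : ℝ :=
  (1 / 2) * ∑ w : ColoredPerm n p, |P.coeff w - Q.coeff w|

/-- The distance to uniformity after `k` top to random shuffles. -/
noncomputable def shuffleDist (n p k : ℕ) [NeZero p] : ℝ :=
  tvDist (topToRandom n p ^ k) (uniformDist n p)

/-! Left multiplication by a term of `B_1` picks a label `j`, makes it the smallest label and adds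
`a` to its color. The labels never picked in `k` steps therefore end up as the largest ones, in
their original order and with color `0`, while everything else is uniform. So the law after `k`
shuffles is a mixture, over the number `i` of coupons missing after `k` draws from `n`, of the
uniform laws on the elements whose last `i` labels are sorted (`coeff_topToRandom_pow`).
Algebraically this is the rule that `B_1` sends the indicator `D_r` of a tail sorted from `r` on to
`r p D_r + D_{r+1}` (`sum_tailSorted_insertTop_inv_mul`).

The density of this law against `U` thus depends only on the length `L` of the longest sorted tail,
and the distance becomes a single sum over `L` (`shuffleDist_eq`). Everything else is coupon
collecting. Let `M = n (1 - 1/n)^k` be the mean number of missing coupons.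

Upper bound: the density is at least the probability that no coupon is missing, so the distance is
at most `M`.

Lower bound: the event `L ≥ l` has probability at most `1 / l!` under `U`, but contains the event
that at least `l` coupons are missing. A generating function bound makes fewer than `M / 4` missing
coupons exponentially unlikely.

Limit at `n log n + c n`: the missing count becomes Poisson with mean `x = exp (-c)`, by
inclusion-exclusion and dominated convergence. Passing to the limit in the sum over `L` gives `f(c)
= limitDist p x`, and the limiting form of the upper bound gives `f(c) ≤ x`. -/

/-! ### The shuffle element as a sum over insertions of the top letter -/

theorem wordShuffle_singleton {α : Type*} (x : α) (v : List α) :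
    wordShuffle [x] v = ∑ j : Fin (v.length + 1), {v.insertIdx j x} := by
  induction v with
  | nil => simp [wordShuffle]
  | cons b v ih =>
    have h := map_sum (Multiset.mapAddMonoidHom (b :: ·))
      (fun j : Fin (v.length + 1) => ({v.insertIdx j x} : Multiset (List α))) Finset.univ
    simp only [Multiset.coe_mapAddMonoidHom, Multiset.map_singleton] at h
    rw [wordShuffle, ih, h, List.length_cons, Fin.sum_univ_succ (n := v.length + 1)]
    simp [wordShuffle, add_comm]

namespace ColoredPerm

/-- The colored permutation moving the top card to position `j` and adding `a` to its color. -/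
def insertTop {m p : ℕ} (a : ZMod p) (j : Fin (m + 1)) : ColoredPerm (m + 1) p :=
  ⟨Pi.single j a, j.cycleRange⟩

theorem word_injective {n p : ℕ} : Function.Injective (word : ColoredPerm n p → _) := by
  intro g h hgh
  have := List.ofFn_injective hgh
  ext i
  · exact congrArg Prod.fst (congrFun this i)
  · have := congrArg Prod.snd (congrFun this i)
    simpa using this

theorem insertTop_word {m p : ℕ} (a : ZMod p) (j : Fin (m + 1)) :
    (insertTop a j).word = (tailWord 1 (m + 1) p).insertIdx j (a, 1) := by
  have hl : (tailWord 1 (m + 1) p).length = m := by simp [tailWord]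
  apply List.ext_getElem
  · rw [List.length_insertIdx_of_le_length (by omega)]
    simp [word, hl]
  · intro i h1 h2
    have hi : i < m + 1 := by simpa [word] using h1
    rw [List.getElem_insertIdx]
    simp only [word, insertTop, List.getElem_ofFn, tailWord, List.getElem_map,
      List.getElem_range']
    rcases lt_trichotomy i (j : ℕ) with h | h | h
    · have hlt : (⟨i, hi⟩ : Fin (m + 1)) < j := h
      rw [dif_pos h, Pi.single_eq_of_ne hlt.ne, Fin.coe_cycleRange_of_lt hlt]
      simp; omega
    · have he : (⟨i, hi⟩ : Fin (m + 1)) = j := Fin.ext h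
      rw [dif_neg (by omega), dif_pos h, he, Fin.cycleRange_self]
      simp
    · have hlt : j < (⟨i, hi⟩ : Fin (m + 1)) := h
      rw [dif_neg (by omega), dif_neg (by omega), Pi.single_eq_of_ne hlt.ne',
        Fin.cycleRange_of_gt hlt]
      simp; omega

/-- A colored permutation of one letter is its color. -/
def equivColor (p : ℕ) : ColoredPerm 1 p ≃ ZMod p where
  toFun g := g.color 0
  invFun a := ⟨fun _ => a, 1⟩
  left_inv g := by
    ext i
    · simp [Subsingleton.elim i 0]
    · simp
  right_inv _ := rfl

end ColoredPerm

open ColoredPerm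

theorem shuffleElement_one_eq_sum (m p : ℕ) [NeZero p] :
    shuffleElement (m + 1) p 1 =
      ∑ a : ZMod p, ∑ j : Fin (m + 1), MonoidAlgebra.single (insertTop a j) (1 : ℝ) := by
  classical
  rw [shuffleElement]
  have key : ∀ g : ColoredPerm (m + 1) p,
      (∑ α : ColoredPerm 1 p,
        ((wordShuffle α.word (tailWord 1 (m + 1) p)).count g.word : ℝ)) =
      ∑ a : ZMod p, ∑ j : Fin (m + 1), if insertTop a j = g then (1 : ℝ) else 0 := by
    intro g
    rw [← Equiv.sum_comp (equivColor p)]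
    refine Finset.sum_congr rfl fun α _ => ?_
    have hw : α.word = [(equivColor p α, 1)] := by simp [word, equivColor]
    have hl : (tailWord 1 (m + 1) p).length + 1 = m + 1 := by simp [tailWord]
    rw [hw, wordShuffle_singleton, Multiset.count_sum', ← Equiv.sum_comp (finCongr hl)]
    push_cast
    refine Finset.sum_congr rfl fun j _ => ?_
    rw [Multiset.count_singleton]
    have h2 := insertTop_word (equivColor p α) (finCongr hl j)
    have h3 : ((finCongr hl j : Fin (m + 1)) : ℕ) = j := rfl
    rw [h3] at h2
    simp only [← h2, word_injective.eq_iff]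
    simp [eq_comm]
  ext w
  simp [key, MonoidAlgebra.coeff_sum, Finsupp.finsetSum_apply, Finsupp.single_apply]

theorem coeff_topToRandom_mul (m p : ℕ) [NeZero p]
    (x : MonoidAlgebra ℝ (ColoredPerm (m + 1) p)) (w : ColoredPerm (m + 1) p) :
    (topToRandom (m + 1) p * x).coeff w =
      1 / (((m + 1 : ℕ) : ℝ) * p) *
        ∑ a : ZMod p, ∑ j : Fin (m + 1), x.coeff ((insertTop a j)⁻¹ * w) := by
  rw [topToRandom, shuffleElement_one_eq_sum, smul_mul_assoc, MonoidAlgebra.coeff_smul_apply]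
  simp [Finset.sum_mul, MonoidAlgebra.coeff_sum, Finsupp.finsetSum_apply]

/-! ### Sorted tails and the action of one shuffle on their indicators -/

/-- The cards with labels `≥ r` are in increasing order and have color `0`. -/
def TailSorted {n p : ℕ} (r : ℕ) (w : ColoredPerm n p) : Prop :=
  (∀ a b : Fin n, r ≤ (a : ℕ) → a < b → w.perm⁻¹ a < w.perm⁻¹ b) ∧
    ∀ a : Fin n, r ≤ (a : ℕ) → w.color (w.perm⁻¹ a) = 0

theorem TailSorted.mono {n p r s : ℕ} {w : ColoredPerm n p} (h : TailSorted r w) (hrs : r ≤ s) :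
    TailSorted s w :=
  ⟨fun a b ha => h.1 a b (hrs.trans ha), fun a ha => h.2 a (hrs.trans ha)⟩

theorem tailSorted_of_le {n p r : ℕ} (w : ColoredPerm n p) (h : n ≤ r) : TailSorted r w :=
  ⟨fun a _ ha => absurd a.2 (by omega), fun a ha => absurd a.2 (by omega)⟩

theorem tailSorted_zero_iff {n p : ℕ} (w : ColoredPerm n p) : TailSorted 0 w ↔ w = 1 := by
  constructor
  · rintro ⟨h1, h2⟩
    have hm : StrictMono (w.perm⁻¹ : Equiv.Perm (Fin n)) := fun a b hab => h1 a b (Nat.zero_le _) hab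
    have hp : w.perm = 1 := by
      have := Subsingleton.elim
        (hm.orderIsoOfSurjective _ (w.perm⁻¹ : Equiv.Perm (Fin n)).surjective) (OrderIso.refl _)
      rw [← inv_eq_one]
      ext i
      exact congrArg (fun e : Fin n ≃o Fin n => ((e i : Fin n) : ℕ)) this
    ext i
    · simpa [hp] using h2 i (Nat.zero_le _)
    · simp [hp]
  · rintro rfl
    exact ⟨fun a b _ h => by simpa using h, fun a _ => by simp⟩

section InsertTop

variable {m p : ℕ} (a : ZMod p) (j : Fin (m + 1)) (w : ColoredPerm (m + 1) p)

theorem insertTop_inv_mul_perm_inv (b : Fin (m + 1)) :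
    ((insertTop a j)⁻¹ * w).perm⁻¹ b = w.perm⁻¹ (j.cycleRange b) := by
  simp [insertTop]

theorem insertTop_inv_mul_color (b : Fin (m + 1)) :
    ((insertTop a j)⁻¹ * w).color (((insertTop a j)⁻¹ * w).perm⁻¹ b) =
      w.color (w.perm⁻¹ (j.cycleRange b)) - if b = j then a else 0 := by
  rw [insertTop_inv_mul_perm_inv]
  simp [insertTop, Pi.single_apply]
  ring

theorem tailSorted_insertTop_inv_mul (r : ℕ) :
    TailSorted r ((insertTop a j)⁻¹ * w) ↔
      (∀ b c : Fin (m + 1), r ≤ (b : ℕ) → b < c →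
        w.perm⁻¹ (j.cycleRange b) < w.perm⁻¹ (j.cycleRange c)) ∧
      ∀ b : Fin (m + 1), r ≤ (b : ℕ) →
        (w.color (w.perm⁻¹ (j.cycleRange b)) - if b = j then a else 0) = 0 := by
  unfold TailSorted
  refine and_congr (forall₄_congr fun b c _ _ => ?_) (forall₂_congr fun b _ => ?_)
  · rw [insertTop_inv_mul_perm_inv, insertTop_inv_mul_perm_inv]
  · rw [insertTop_inv_mul_color]

/-- The cycle `j.cycleRange` fixes every label above `j`, hence the whole tail. These `r p` choices
of `(a, j)` give the diagonal term of the recursion. -/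
theorem tailSorted_insertTop_inv_mul_of_lt {r : ℕ} (hj : (j : ℕ) < r) :
    TailSorted r ((insertTop a j)⁻¹ * w) ↔ TailSorted r w := by
  have h : ∀ b : Fin (m + 1), r ≤ (b : ℕ) → j.cycleRange b = b ∧ b ≠ j := fun b hb =>
    have hb : j < b := Fin.lt_def.2 (by omega)
    ⟨Fin.cycleRange_of_gt hb, hb.ne'⟩
  rw [tailSorted_insertTop_inv_mul]
  unfold TailSorted
  refine and_congr (forall₄_congr fun b c hb hbc => ?_) (forall₂_congr fun b hb => ?_)
  · rw [(h b hb).1, (h c (hb.trans hbc.le)).1]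
  · rw [(h b hb).1, if_neg (h b hb).2, sub_zero]

/-- The position of the top card among the cards `> r` is between the cards `j` and `j + 1`. -/
def IsSlot (r : ℕ) : Prop :=
  ∀ c : Fin (m + 1), r < (c : ℕ) →
    (c ≤ j → w.perm⁻¹ c < w.perm⁻¹ 0) ∧ (j < c → w.perm⁻¹ 0 < w.perm⁻¹ c)

/-- Undoing the move turns label `0` into label `j` and lowers the labels `1, …, j` by one. So the
tail from `r` on is sorted exactly when the tail from `r + 1` on was, and label `0` stood where `j`
belongs with color `a` to be removed. -/
theorem tailSorted_insertTop_inv_mul_of_le {r : ℕ} (hj : r ≤ (j : ℕ)) :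
    TailSorted r ((insertTop a j)⁻¹ * w) ↔
      TailSorted (r + 1) w ∧ a = w.color (w.perm⁻¹ 0) ∧ IsSlot j w r := by
  have hc1 : ∀ b, b < j → ((j.cycleRange b : Fin (m + 1)) : ℕ) = b + 1 := fun b hb =>
    Fin.coe_cycleRange_of_lt hb
  have hc2 : j.cycleRange j = 0 := Fin.cycleRange_self j
  have hc3 : ∀ b, j < b → j.cycleRange b = b := fun b hb => Fin.cycleRange_of_gt hb
  -- every label `> r` is the image of a label `≥ r` other than `j`
  have hs : ∀ c : Fin (m + 1), r < (c : ℕ) → ∃ b : Fin (m + 1), r ≤ (b : ℕ) ∧ b ≠ j ∧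
      j.cycleRange b = c ∧ (b < j ↔ c ≤ j) ∧ (b : ℕ) ≤ c ∧ (c : ℕ) ≤ b + 1 ∧ (j < c → b = c) ∧
      (c ≤ j → (b : ℕ) + 1 = c) := by
    intro c hc
    rcases le_or_gt c j with h | h
    · have hlt : (⟨c - 1, by omega⟩ : Fin (m + 1)) < j := by
        rw [Fin.le_def] at h; rw [Fin.lt_def]; change (c : ℕ) - 1 < j; omega
      refine ⟨⟨c - 1, by omega⟩, by change r ≤ (c : ℕ) - 1; omega, hlt.ne, ?_, by simp [h, hlt],
        by simp, by change (c : ℕ) ≤ c - 1 + 1; omega, fun h' => absurd h (not_le.2 h'),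
        fun _ => by change (c : ℕ) - 1 + 1 = c; omega⟩
      ext
      rw [hc1 _ hlt]; change (c : ℕ) - 1 + 1 = c; omega
    · exact ⟨c, hc.le, h.ne', hc3 c h, iff_of_false (not_lt.2 h.le) (not_le.2 h), le_rfl, by omega, fun _ => rfl,
        fun h' => absurd h (not_lt.2 h')⟩
  rw [tailSorted_insertTop_inv_mul]
  unfold TailSorted
  constructor
  · rintro ⟨h1, h2⟩
    refine ⟨⟨fun c d hc hcd => ?_, fun c hc => ?_⟩, ?_, fun c hc => ⟨fun hcj => ?_, fun hcj => ?_⟩⟩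
    · obtain ⟨b, hb, -, rfl, hb2, hb3, hb4, hb5, hb6⟩ := hs c (by omega)
      obtain ⟨e, he, -, rfl, he2, he3, he4, he5, he6⟩ := hs d (by rw [Fin.lt_def] at hcd; omega)
      refine h1 b e hb ?_
      rw [Fin.lt_def] at hcd ⊢
      rw [Fin.le_def] at hb6 he6
      rw [Fin.lt_def] at hb5 he5
      rcases le_or_gt ((j.cycleRange e : Fin (m + 1)) : ℕ) j with h | h
      · have := he6 h
        omega
      · have := congrArg Fin.val (he5 h)
        rcases le_or_gt ((j.cycleRange b : Fin (m + 1)) : ℕ) j with h' | h'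
        · have := hb6 h'; omega
        · have := congrArg Fin.val (hb5 h'); omega
    · obtain ⟨b, hb, hbj, rfl, -⟩ := hs c (by omega)
      simpa [hbj] using h2 b hb
    · have := h2 j hj
      rw [hc2, if_pos rfl, sub_eq_zero] at this
      exact this.symm
    · obtain ⟨b, hb, -, rfl, hb2, -⟩ := hs c hc
      have := h1 b j hb (hb2.2 hcj)
      rwa [hc2] at this
    · have := h1 j c hj hcj
      rwa [hc2, hc3 c hcj] at this
  · rintro ⟨⟨h1, h2⟩, ha, h3⟩
    refine ⟨fun b c hb hbc => ?_, fun b hb => ?_⟩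
    · have hc : r < (c : ℕ) := lt_of_le_of_lt hb hbc
      rcases lt_trichotomy b j with hbj | rfl | hbj
      · have hb1 := hc1 b hbj
        rcases lt_trichotomy c j with hcj | rfl | hcj
        · have hc1 := hc1 c hcj
          refine h1 _ _ (by omega) ?_
          rw [Fin.lt_def] at hbc ⊢; omega
        · rw [hc2]
          refine (h3 _ (by omega)).1 ?_
          rw [Fin.lt_def] at hbj; rw [Fin.le_def]; omega
        · rw [hc3 c hcj]
          refine h1 _ _ (by omega) ?_
          rw [Fin.lt_def] at hbj hcj ⊢; omega
      · rw [hc2, hc3 c hbc]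
        exact (h3 c hc).2 hbc
      · have hcj := hbj.trans hbc
        rw [hc3 b hbj, hc3 c hcj]
        exact h1 b c (by rw [Fin.lt_def] at hbj; omega) hbc
    · rcases lt_trichotomy b j with hbj | rfl | hbj
      · rw [h2 _ (by rw [hc1 b hbj]; omega), if_neg hbj.ne, sub_zero]
      · rw [hc2, if_pos rfl, ha, sub_self]
      · rw [hc3 b hbj, h2 b (by rw [Fin.lt_def] at hbj; omega), if_neg hbj.ne', sub_zero]

theorem existsUnique_isSlot {r : ℕ} (hr : r < m + 1) (hw : TailSorted (r + 1) w) :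
    ∃! j : Fin (m + 1), r ≤ (j : ℕ) ∧ IsSlot j w r := by
  classical
  -- The slot is the largest tail label placed before label `0`; `r` itself is admitted as the value
  -- when no label above `r` precedes it.
  let S : Finset (Fin (m + 1)) := Finset.univ.filter fun c =>
    r ≤ (c : ℕ) ∧ ((c : ℕ) = r ∨ w.perm⁻¹ c < w.perm⁻¹ 0)
  have hS : S.Nonempty := ⟨⟨r, hr⟩, by simp [S]⟩
  have hmem := S.max'_mem hS
  set j := S.max' hS with hjdef
  have hj : r ≤ (j : ℕ) ∧ ((j : ℕ) = r ∨ w.perm⁻¹ j < w.perm⁻¹ 0) := by simpa [S] using hmem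
  have hjs : IsSlot j w r := by
    refine fun c hc => ⟨fun hcj => ?_, fun hcj => ?_⟩
    · have hj2 : w.perm⁻¹ j < w.perm⁻¹ 0 := by
        rcases hj.2 with h | h
        · rw [Fin.le_def] at hcj; omega
        · exact h
      rcases hcj.eq_or_lt with rfl | hlt
      · exact hj2
      · exact (hw.1 c j hc hlt).trans hj2
    · have hcS : c ∉ S := fun h => absurd (S.le_max' c h) (not_le.2 hcj)
      have hle : w.perm⁻¹ 0 ≤ w.perm⁻¹ c := by
        by_contra h
        exact hcS (by simp [S]; exact ⟨hc.le, Or.inr (not_le.1 h)⟩)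
      refine lt_of_le_of_ne hle fun h => ?_
      have := (w.perm⁻¹ : Equiv.Perm (Fin (m + 1))).injective h
      rw [← this] at hc
      simp at hc
  refine ⟨j, ⟨hj.1, hjs⟩, ?_⟩
  · have key : ∀ i k : Fin (m + 1), r ≤ (i : ℕ) → IsSlot i w r → IsSlot k w r → ¬ i < k := by
      intro i k hi h1 h2 hik
      have hk : r < (k : ℕ) := lt_of_le_of_lt hi hik
      exact lt_asymm ((h1 k hk).2 hik) ((h2 k hk).1 le_rfl)
    rintro k ⟨hk, hks⟩
    exact le_antisymm (not_lt.1 (key j k hj.1 hjs hks)) (not_lt.1 (key k j hk hks hjs))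

-- Of the pairs with `j ≥ r` exactly one contributes when the tail from `r + 1` on is sorted: the
-- color is forced by label `0` and the slot is unique.
open Classical in
theorem sum_tailSorted_insertTop_inv_mul [NeZero p] {r : ℕ} (hr : r < m + 1) :
    (∑ a : ZMod p, ∑ j : Fin (m + 1),
      if TailSorted r ((insertTop a j)⁻¹ * w) then (1 : ℝ) else 0) =
    r * p * (if TailSorted r w then 1 else 0) + if TailSorted (r + 1) w then 1 else 0 := by
  rw [Finset.sum_comm]
  have hlt : ∀ j : Fin (m + 1), (j : ℕ) < r →
      (∑ a : ZMod p, if TailSorted r ((insertTop a j)⁻¹ * w) then (1 : ℝ) else 0) =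
        p * if TailSorted r w then 1 else 0 := by
    intro j hj
    simp [tailSorted_insertTop_inv_mul_of_lt _ _ _ hj, ZMod.card]
  have hle : ∀ j : Fin (m + 1), ¬ (j : ℕ) < r →
      (∑ a : ZMod p, if TailSorted r ((insertTop a j)⁻¹ * w) then (1 : ℝ) else 0) =
        if TailSorted (r + 1) w ∧ IsSlot j w r then 1 else 0 := by
    intro j hj
    simp only [tailSorted_insertTop_inv_mul_of_le _ _ _ (not_lt.1 hj)]
    rw [Finset.sum_eq_single (w.color (w.perm⁻¹ 0))]
    · simp
    · intro b _ hb; exact if_neg fun h => hb h.2.1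
    · simp
  rw [← Finset.sum_filter_add_sum_filter_not _ (fun j : Fin (m + 1) => (j : ℕ) < r)]
  congr 1
  · rw [Finset.sum_congr rfl fun j hj => hlt j (Finset.mem_filter.1 hj).2, Finset.sum_const,
      nsmul_eq_mul]
    have : (Finset.univ.filter fun j : Fin (m + 1) => (j : ℕ) < r).card = r := by
      rw [Fin.card_filter_val_lt, min_eq_right hr.le]
    rw [this, mul_assoc]
  · rw [Finset.sum_congr rfl fun j hj => hle j (Finset.mem_filter.1 hj).2]
    by_cases hw : TailSorted (r + 1) w
    · obtain ⟨j, ⟨hj, hjs⟩, hu⟩ := existsUnique_isSlot w hr hw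
      rw [Finset.sum_eq_single j]
      · simp [hw, hjs]
      · intro k hk hkj
        refine if_neg fun h => hkj (hu k ⟨not_lt.1 (Finset.mem_filter.1 hk).2, h.2⟩)
      · intro h
        exact absurd (Finset.mem_filter.2 ⟨Finset.mem_univ j, not_lt.2 hj⟩) h
    · simp [hw]

end InsertTop

/-! ### The coupon collector chain -/

/-- The probability that `i` out of `n` coupons are missing after `k` draws. -/
noncomputable def missingProb (n : ℕ) : ℕ → ℕ → ℝ
  | 0, i => if i = n then 1 else 0
  | k + 1, i =>
    (1 - (i : ℝ) / n) * missingProb n k i + ((i : ℝ) + 1) / n * missingProb n k (i + 1)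

theorem missingProb_succ (n k i : ℕ) : missingProb n (k + 1) i =
    (1 - (i : ℝ) / n) * missingProb n k i + ((i : ℝ) + 1) / n * missingProb n k (i + 1) := rfl

theorem missingProb_of_lt {n k i : ℕ} (h : n < i) : missingProb n k i = 0 := by
  induction k generalizing i with
  | zero => simp [missingProb, h.ne']
  | succ k ih => rw [missingProb_succ, ih h, ih (by omega)]; simp

theorem missingProb_nonneg (n k i : ℕ) : 0 ≤ missingProb n k i := by
  rcases lt_or_ge n i with h | h
  · rw [missingProb_of_lt h]
  induction k generalizing i with
  | zero => rw [missingProb]; split_ifs <;> norm_num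
  | succ k ih =>
    rw [missingProb_succ]
    have h1 : (i : ℝ) / n ≤ 1 := div_le_one_of_le₀ (by exact_mod_cast h) (by positivity)
    have h2 : 0 ≤ missingProb n k (i + 1) := by
      rcases h.eq_or_lt with rfl | h
      · rw [missingProb_of_lt (by omega)]
      · exact ih (i + 1) h
    have := ih i h
    have h3 : 0 ≤ 1 - (i : ℝ) / n := by linarith
    positivity

/-- The dual form of the recursion: the transition operator is moved onto the test function.
Inductions for the mean, the generating function and the mixture formula all start here. At `i = 0`
the truncated `i - 1` is harmless, its coefficient being zero. -/
theorem sum_missingProb_succ_mul (n k : ℕ) (φ : ℕ → ℝ) :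
    ∑ i ∈ Finset.range (n + 1), missingProb n (k + 1) i * φ i =
      ∑ i ∈ Finset.range (n + 1), missingProb n k i *
        ((1 - (i : ℝ) / n) * φ i + (i : ℝ) / n * φ (i - 1)) := by
  have h : ∑ i ∈ Finset.range (n + 1), ((i : ℝ) + 1) / n * missingProb n k (i + 1) * φ i =
      ∑ i ∈ Finset.range (n + 1), missingProb n k i * ((i : ℝ) / n * φ (i - 1)) := by
    rw [Finset.sum_range_succ, missingProb_of_lt (Nat.lt_succ_self n), Finset.sum_range_succ']
    simp only [Nat.cast_zero, zero_div, zero_mul, mul_zero, add_zero, Nat.add_sub_cancel]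
    refine Finset.sum_congr rfl fun i _ => ?_
    push_cast
    ring
  simp only [missingProb_succ, add_mul, mul_add, Finset.sum_add_distrib, h]
  congr 1
  exact Finset.sum_congr rfl fun i _ => by ring

theorem sum_missingProb_zero_mul (n : ℕ) (φ : ℕ → ℝ) :
    ∑ i ∈ Finset.range (n + 1), missingProb n 0 i * φ i = φ n := by
  simp [missingProb]

theorem sum_missingProb (n k : ℕ) : ∑ i ∈ Finset.range (n + 1), missingProb n k i = 1 := by
  induction k with
  | zero => simpa using sum_missingProb_zero_mul n fun _ => 1
  | succ k ih =>
    have := sum_missingProb_succ_mul n k fun _ => 1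
    simpa [ih] using this

/-! ### The law after `k` shuffles as a mixture -/

open Classical in
/-- The indicator of `TailSorted`. -/
noncomputable def tailInd {n p : ℕ} (r : ℕ) (w : ColoredPerm n p) : ℝ :=
  if TailSorted r w then 1 else 0

theorem tailInd_of_le {n p r : ℕ} (w : ColoredPerm n p) (h : n ≤ r) : tailInd r w = 1 :=
  if_pos (tailSorted_of_le w h)

theorem sum_tailInd_insertTop_inv_mul {m p : ℕ} [NeZero p] (w : ColoredPerm (m + 1) p) {i : ℕ}
    (hi : i ≤ m + 1) :
    ∑ a : ZMod p, ∑ j : Fin (m + 1), tailInd (m + 1 - i) ((insertTop a j)⁻¹ * w) =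
      (((m + 1 : ℕ) : ℝ) - i) * p * tailInd (m + 1 - i) w +
        if i = 0 then 0 else tailInd (m + 1 - (i - 1)) w := by
  rcases Nat.eq_zero_or_pos i with rfl | h
  · simp [tailInd_of_le, ZMod.card]
    ring
  · have := sum_tailSorted_insertTop_inv_mul w (show m + 1 - i < m + 1 by omega)
    rw [if_neg h.ne', show m + 1 - (i - 1) = m + 1 - i + 1 by omega, ← Nat.cast_sub hi]
    exact this

/-- With the factor `p ^ i * i!` each indicator becomes a probability law, and the recursion for
indicators becomes the transition `i ↦ i` with weight `1 - i/n` and `i ↦ i - 1` with weight `i/n`,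
that is, one coupon draw. -/
theorem coeff_topToRandom_pow (m p k : ℕ) [NeZero p] (w : ColoredPerm (m + 1) p) :
    (topToRandom (m + 1) p ^ k).coeff w =
      ∑ i ∈ Finset.range (m + 1 + 1), missingProb (m + 1) k i *
        ((p : ℝ) ^ i * i.factorial / ((p : ℝ) ^ (m + 1) * (m + 1).factorial) *
          tailInd (m + 1 - i) w) := by
  have hp : (p : ℝ) ≠ 0 := Nat.cast_ne_zero.2 (NeZero.ne p)
  induction k generalizing w with
  | zero =>
    rw [sum_missingProb_zero_mul, pow_zero, div_self (by positivity), Nat.sub_self, tailInd,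
      tailSorted_zero_iff]
    classical
    rw [MonoidAlgebra.one_def, MonoidAlgebra.coeff_single, Finsupp.single_apply]
    simp [eq_comm]
  | succ k ih =>
    rw [pow_succ', coeff_topToRandom_mul, sum_missingProb_succ_mul]
    simp only [ih]
    simp only [Finset.mul_sum]
    rw [Finset.sum_congr rfl fun a _ => Finset.sum_comm, Finset.sum_comm]
    refine Finset.sum_congr rfl fun i hi => ?_
    have hi : i ≤ m + 1 := by simpa [Nat.lt_succ_iff] using hi
    have := sum_tailInd_insertTop_inv_mul w hi
    simp only [← mul_assoc, ← Finset.mul_sum, this]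
    have hn : (m : ℝ) + 1 ≠ 0 := by positivity
    rcases Nat.eq_zero_or_pos i with rfl | h
    · simp; field_simp
    · obtain ⟨i, rfl⟩ : ∃ l, i = l + 1 := ⟨i - 1, by omega⟩
      simp only [Nat.add_sub_cancel, Nat.factorial_succ i, pow_succ (p : ℝ) i,
        Nat.succ_ne_zero i, if_false]
      push_cast
      field_simp

/-- Counting by the recursion itself: summed over the group, translations drop out, and the counts
`S_i` satisfy `i p S_i = S_{i-1}`. -/
theorem sum_tailInd (m p : ℕ) [NeZero p] {i : ℕ} (hi : i ≤ m + 1) :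
    ∑ w : ColoredPerm (m + 1) p, tailInd (m + 1 - i) w =
      (p : ℝ) ^ (m + 1) * (m + 1).factorial / ((p : ℝ) ^ i * i.factorial) := by
  have hp : (p : ℝ) ≠ 0 := Nat.cast_ne_zero.2 (NeZero.ne p)
  induction i with
  | zero =>
    simp only [Nat.sub_zero, tailInd_of_le _ le_rfl, Finset.sum_const, nsmul_eq_mul, mul_one]
    rw [Finset.card_univ, Fintype.card_congr (equivProd (m + 1) p)]
    simp [ZMod.card, Fintype.card_perm]
  | succ i ih =>
    have h := Finset.sum_congr (rfl : (Finset.univ : Finset (ColoredPerm (m + 1) p)) = _)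
      fun w _ => sum_tailInd_insertTop_inv_mul w hi
    rw [Finset.sum_comm, Finset.sum_add_distrib, ← Finset.mul_sum] at h
    have h2 : ∀ (a : ZMod p), ∑ w : ColoredPerm (m + 1) p, ∑ j : Fin (m + 1),
        tailInd (m + 1 - (i + 1)) ((insertTop a j)⁻¹ * w) =
        (m + 1 : ℕ) * ∑ w : ColoredPerm (m + 1) p, tailInd (m + 1 - (i + 1)) w := by
      intro a
      rw [Finset.sum_comm]
      have (j : Fin (m + 1)) := Equiv.sum_comp (Equiv.mulLeft (insertTop a j)⁻¹)
        fun w : ColoredPerm (m + 1) p => tailInd (m + 1 - (i + 1)) w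
      simp only [Equiv.coe_mulLeft] at this
      rw [Finset.sum_congr rfl fun j _ => this j]
      simp
    simp only [h2, Finset.sum_const, Finset.card_univ, ZMod.card, if_neg (Nat.succ_ne_zero i),
      Nat.add_sub_cancel, ih (by omega), nsmul_eq_mul] at h
    have h3 : ((i : ℝ) + 1) * p * ∑ w : ColoredPerm (m + 1) p, tailInd (m + 1 - (i + 1)) w =
        (p : ℝ) ^ (m + 1) * (m + 1).factorial / ((p : ℝ) ^ i * i.factorial) := by
      push_cast at h ⊢
      linear_combination h
    generalize ∑ w : ColoredPerm (m + 1) p, tailInd (m + 1 - (i + 1)) w = x at h3 ⊢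
    rw [Nat.factorial_succ i, pow_succ (p : ℝ) i]
    push_cast
    rw [eq_div_iff (by positivity)] at h3 ⊢
    linear_combination h3

/-! ### The distance as a sum over the length of the sorted tail -/

/-- The probability under the uniform distribution that the last `l` cards are sorted. -/
noncomputable def sortedProb (n p l : ℕ) : ℝ :=
  if l ≤ n then 1 / ((p : ℝ) ^ l * l.factorial) else 0

/-- The density after `k` shuffles at an element whose sorted tail has length `l`. -/
noncomputable def shuffleDensity (n p k l : ℕ) : ℝ :=
  ∑ i ∈ Finset.range (l + 1), missingProb n k i * ((p : ℝ) ^ i * i.factorial)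

theorem exists_tailInd_eq {n p : ℕ} (w : ColoredPerm n p) :
    ∃ L ≤ n, ∀ i ≤ n, tailInd (n - i) w = if i ≤ L then 1 else 0 := by
  classical
  have h0 : TailSorted (n - 0) w := tailSorted_of_le w le_rfl
  refine ⟨Nat.findGreatest (fun i => TailSorted (n - i) w) n, Nat.findGreatest_le n,
    fun i hi => ?_⟩
  rw [tailInd]
  refine if_congr ⟨fun h => Nat.le_findGreatest hi h, fun h => ?_⟩ rfl rfl
  have := Nat.findGreatest_spec (P := fun i => TailSorted (n - i) w) (Nat.zero_le n) h0
  exact this.mono (by omega)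

theorem sum_coeff_topToRandom_pow (m p k : ℕ) [NeZero p] :
    ∑ w, (topToRandom (m + 1) p ^ k).coeff w = 1 := by
  have hp : (p : ℝ) ≠ 0 := Nat.cast_ne_zero.2 (NeZero.ne p)
  simp only [coeff_topToRandom_pow]
  rw [Finset.sum_comm, ← sum_missingProb (m + 1) k]
  refine Finset.sum_congr rfl fun i hi => ?_
  rw [← Finset.mul_sum, ← Finset.mul_sum, sum_tailInd m p (by simpa [Nat.lt_succ_iff] using hi)]
  field_simp

theorem coeff_uniformDist (n p : ℕ) [NeZero p] (w : ColoredPerm n p) :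
    (uniformDist n p).coeff w = 1 / ((p : ℝ) ^ n * n.factorial) := by
  classical
  simp [uniformDist, MonoidAlgebra.coeff_sum, Finsupp.finsetSum_apply, Finsupp.single_apply]

theorem sum_coeff_uniformDist (m p : ℕ) [NeZero p] :
    ∑ w, (uniformDist (m + 1) p).coeff w = 1 := by
  have hp : (p : ℝ) ≠ 0 := Nat.cast_ne_zero.2 (NeZero.ne p)
  have := sum_tailInd m p (Nat.zero_le _)
  simp only [Nat.sub_zero, tailInd_of_le _ le_rfl] at this
  simp only [coeff_uniformDist]
  rw [Finset.sum_congr rfl fun w _ => (mul_one (_ : ℝ)).symm, ← Finset.mul_sum, this]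
  simp
  field_simp

/-- For equal total mass the two one-sided excesses agree. The side where `P` is deficient is kept:
with `P ≥ 0` its terms never exceed those of `Q`, which later supplies the domination. -/
theorem tvDist_eq_sum_max {n p : ℕ} [NeZero p] (P Q : MonoidAlgebra ℝ (ColoredPerm n p))
    (h : ∑ w, P.coeff w = ∑ w, Q.coeff w) :
    tvDist P Q = ∑ w, max 0 (Q.coeff w - P.coeff w) := by
  have key : ∀ x y : ℝ, |x - y| = 2 * max 0 (y - x) + (x - y) := by
    intro x y
    rcases le_total x y with h | h
    · rw [abs_of_nonpos (by linarith), max_eq_right (by linarith)]; ring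
    · rw [abs_of_nonneg (by linarith), max_eq_left (by linarith)]; ring
  rw [tvDist]
  simp only [key, Finset.sum_add_distrib, Finset.sum_sub_distrib, h, ← Finset.mul_sum]
  ring

theorem sum_tailInd_eq_sortedProb (m p l : ℕ) [NeZero p] :
    1 / ((p : ℝ) ^ (m + 1) * (m + 1).factorial) *
      ∑ w : ColoredPerm (m + 1) p, (if l ≤ m + 1 then tailInd (m + 1 - l) w else 0) =
      sortedProb (m + 1) p l := by
  have hp : (p : ℝ) ≠ 0 := Nat.cast_ne_zero.2 (NeZero.ne p)
  rw [sortedProb]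
  split_ifs with h
  · rw [sum_tailInd m p h]
    field_simp
  · simp

/-- Sorted tails are nested, so the difference of consecutive indicators is the indicator of `L =
l`, on which the density is constant. -/
theorem shuffleDist_eq (m p k : ℕ) [NeZero p] :
    shuffleDist (m + 1) p k = ∑ l ∈ Finset.range (m + 1 + 1),
      (sortedProb (m + 1) p l - sortedProb (m + 1) p (l + 1)) *
        max 0 (1 - shuffleDensity (m + 1) p k l) := by
  have hp : (p : ℝ) ≠ 0 := Nat.cast_ne_zero.2 (NeZero.ne p)
  have hN : 0 < 1 / ((p : ℝ) ^ (m + 1) * (m + 1).factorial) := by positivity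
  rw [shuffleDist, tvDist_eq_sum_max _ _
    ((sum_coeff_topToRandom_pow m p k).trans (sum_coeff_uniformDist m p).symm)]
  have key : ∀ w : ColoredPerm (m + 1) p,
      max 0 ((uniformDist (m + 1) p).coeff w - (topToRandom (m + 1) p ^ k).coeff w) =
      ∑ l ∈ Finset.range (m + 1 + 1), 1 / ((p : ℝ) ^ (m + 1) * (m + 1).factorial) *
        ((if l ≤ m + 1 then tailInd (m + 1 - l) w else 0) -
          (if l + 1 ≤ m + 1 then tailInd (m + 1 - (l + 1)) w else 0)) *
        max 0 (1 - shuffleDensity (m + 1) p k l) := by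
    intro w
    obtain ⟨L, hL, hT⟩ := exists_tailInd_eq w
    have h1 : (topToRandom (m + 1) p ^ k).coeff w =
        1 / ((p : ℝ) ^ (m + 1) * (m + 1).factorial) * shuffleDensity (m + 1) p k L := by
      rw [coeff_topToRandom_pow, shuffleDensity, Finset.mul_sum]
      symm
      refine Finset.sum_subset_zero_on_sdiff (Finset.range_subset_range.2 (by omega))
        (fun i hi => ?_) fun i hi => ?_
      · simp only [Finset.mem_sdiff, Finset.mem_range] at hi
        rw [hT i (by omega), if_neg (by omega)]
        simp
      · simp only [Finset.mem_range] at hi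
        rw [hT i (by omega), if_pos (by omega)]
        ring
    rw [Finset.sum_eq_single_of_mem L (Finset.mem_range.2 (by omega))]
    · have h2 : (if L + 1 ≤ m + 1 then tailInd (m + 1 - (L + 1)) w else 0) = 0 := by
        split_ifs with h
        · rw [hT _ h, if_neg (by omega)]
        · rfl
      rw [h2, if_pos hL, hT L hL, if_pos le_rfl, h1, coeff_uniformDist, sub_zero, mul_one,
        mul_max_of_nonneg _ _ hN.le, mul_zero, mul_sub, mul_one]
    · intro l hl hlL
      have hl : l ≤ m + 1 := by simpa [Nat.lt_succ_iff] using hl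
      have h2 : (if l + 1 ≤ m + 1 then tailInd (m + 1 - (l + 1)) w else 0) =
          tailInd (m + 1 - l) w := by
        rw [hT l hl]
        split_ifs with h h' h'
        · rw [hT _ h, if_pos (by omega)]
        · rw [hT _ h, if_neg (by omega)]
        · omega
        · rfl
      rw [h2, if_pos hl]
      simp
  simp only [key]
  rw [Finset.sum_comm]
  refine Finset.sum_congr rfl fun l _ => ?_
  rw [← Finset.sum_mul, ← Finset.mul_sum, Finset.sum_sub_distrib, mul_sub,
    sum_tailInd_eq_sortedProb, sum_tailInd_eq_sortedProb]

theorem sum_missingProb_mul_id {n : ℕ} (k : ℕ) (hn : 0 < n) :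
    ∑ i ∈ Finset.range (n + 1), missingProb n k i * i = n * (1 - 1 / (n : ℝ)) ^ k := by
  induction k with
  | zero => simpa using sum_missingProb_zero_mul n fun i => (i : ℝ)
  | succ k ih =>
    rw [sum_missingProb_succ_mul n k fun i => (i : ℝ), pow_succ, ← mul_assoc, ← ih,
      Finset.sum_mul]
    refine Finset.sum_congr rfl fun i _ => ?_
    have hn' : (n : ℝ) ≠ 0 := by positivity
    rcases Nat.eq_zero_or_pos i with rfl | h
    · simp
    · rw [Nat.cast_sub h]
      field_simp
      push_cast
      ring

/-- The right side is the generating function that independent coupons would have. One draw turns `u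
^ i` into the first two terms of `(u + (1 - u)/n) ^ i`, so each step replaces `1 - u` by `(1 - u)(1
- 1/n)`. -/
theorem sum_missingProb_mul_pow_le {n : ℕ} (hn : 0 < n) (k : ℕ) {u : ℝ} (h0 : 0 ≤ u)
    (h1 : u ≤ 1) :
    ∑ i ∈ Finset.range (n + 1), missingProb n k i * u ^ i ≤
      (1 - (1 - u) * (1 - 1 / (n : ℝ)) ^ k) ^ n := by
  have hn' : (0 : ℝ) < n := by exact_mod_cast hn
  have hn1 : 1 / (n : ℝ) ≤ 1 := by
    rw [div_le_one hn']; exact_mod_cast hn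
  induction k generalizing u with
  | zero => rw [sum_missingProb_zero_mul]; simp
  | succ k ih =>
    rw [sum_missingProb_succ_mul]
    have hv : 0 ≤ (1 - u) / n := div_nonneg (by linarith) hn'.le
    have hv1 : (1 - u) / n ≤ 1 - u := div_le_self (by linarith) (by exact_mod_cast hn)
    have hstep : 1 - (1 - u) * (1 - 1 / (n : ℝ)) ^ (k + 1) =
        1 - (1 - (u + (1 - u) / n)) * (1 - 1 / (n : ℝ)) ^ k := by
      rw [pow_succ]; ring
    rw [hstep]
    refine le_trans (Finset.sum_le_sum fun i _ => ?_) (ih (by linarith) (by linarith))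
    refine mul_le_mul_of_nonneg_left ?_ (missingProb_nonneg n k i)
    rcases Nat.eq_zero_or_pos i with rfl | h
    · simp
    · obtain ⟨i, rfl⟩ : ∃ l, i = l + 1 := ⟨i - 1, by omega⟩
      have hb := pow_add_mul_le_add_pow_of_sq_nonneg h0 (sq_nonneg ((1 - u) / n))
        (sq_nonneg _) (by positivity) (i + 1)
      refine le_trans (le_of_eq ?_) hb
      simp only [Nat.add_sub_cancel, pow_succ u i]
      push_cast
      field_simp
      ring

/-! ### Upper and lower bounds for the distance -/

theorem sortedProb_zero (n p : ℕ) : sortedProb n p 0 = 1 := by simp [sortedProb]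

theorem sortedProb_succ_le (n p l : ℕ) [NeZero p] : sortedProb n p (l + 1) ≤ sortedProb n p l := by
  have hp : 0 < p := Nat.pos_of_ne_zero (NeZero.ne p)
  have hp' : (0 : ℝ) < p := by exact_mod_cast hp
  rw [sortedProb, sortedProb]
  split_ifs with h h'
  · refine one_div_le_one_div_of_le (by positivity) ?_
    have h1 : p ^ l * l.factorial ≤ p ^ (l + 1) * (l + 1).factorial :=
      Nat.mul_le_mul (Nat.pow_le_pow_right hp (Nat.le_succ l)) (Nat.factorial_le (Nat.le_succ l))
    exact_mod_cast h1
  · omega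
  · positivity
  · exact le_rfl

theorem sum_sortedProb_sub (n p : ℕ) :
    ∑ l ∈ Finset.range (n + 1), (sortedProb n p l - sortedProb n p (l + 1)) = 1 := by
  rw [Finset.sum_range_sub', sortedProb_zero]
  simp [sortedProb]

theorem shuffleDist_nonneg (n p k : ℕ) [NeZero p] : 0 ≤ shuffleDist n p k := by
  rw [shuffleDist, tvDist]; positivity

theorem missingProb_zero_le_shuffleDensity (n p k l : ℕ) :
    missingProb n k 0 ≤ shuffleDensity n p k l := by
  rw [shuffleDensity, Finset.sum_range_succ']
  simp only [pow_zero, Nat.factorial_zero, Nat.cast_one, mul_one, le_add_iff_nonneg_left]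
  exact Finset.sum_nonneg fun i _ => mul_nonneg (missingProb_nonneg _ _ _) (by positivity)

theorem one_sub_missingProb_zero_le {n : ℕ} (hn : 0 < n) (k : ℕ) :
    1 - missingProb n k 0 ≤ n * (1 - 1 / (n : ℝ)) ^ k := by
  rw [← sum_missingProb_mul_id k hn, ← sum_missingProb n k, Finset.sum_range_succ',
    Finset.sum_range_succ', add_sub_cancel_right]
  simp only [Nat.cast_zero, mul_zero, add_zero]
  refine Finset.sum_le_sum fun i _ => le_mul_of_one_le_right (missingProb_nonneg _ _ _) ?_
  push_cast
  linarith [Nat.cast_nonneg (α := ℝ) i]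

theorem shuffleDist_le {n : ℕ} (hn : 0 < n) (p k : ℕ) [NeZero p] :
    shuffleDist n p k ≤ n * (1 - 1 / (n : ℝ)) ^ k := by
  obtain ⟨m, rfl⟩ : ∃ m, n = m + 1 := ⟨n - 1, by omega⟩
  refine le_trans ?_ (one_sub_missingProb_zero_le hn k)
  have h1 : missingProb (m + 1) k 0 ≤ 1 := by
    rw [← sum_missingProb (m + 1) k]
    exact Finset.single_le_sum (f := missingProb (m + 1) k)
      (fun i _ => missingProb_nonneg _ _ i) (Finset.mem_range.2 (by omega))
  rw [shuffleDist_eq]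
  refine le_of_le_of_eq ?_ (congrArg (· * (1 - missingProb (m + 1) k 0))
    (sum_sortedProb_sub (m + 1) p) |>.trans (one_mul _))
  simp only [Finset.sum_mul]
  refine Finset.sum_le_sum fun l _ => mul_le_mul_of_nonneg_left ?_
    (sub_nonneg.2 (sortedProb_succ_le _ _ _))
  refine max_le (by linarith) ?_
  linarith [missingProb_zero_le_shuffleDensity (m + 1) p k l]

theorem shuffleDensity_nonneg (n p k l : ℕ) : 0 ≤ shuffleDensity n p k l :=
  Finset.sum_nonneg fun i _ => mul_nonneg (missingProb_nonneg _ _ _) (by positivity)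

theorem shuffleDist_le_one {n : ℕ} (hn : 0 < n) (p k : ℕ) [NeZero p] : shuffleDist n p k ≤ 1 := by
  obtain ⟨m, rfl⟩ : ∃ m, n = m + 1 := ⟨n - 1, by omega⟩
  rw [shuffleDist_eq]
  refine le_of_le_of_eq (Finset.sum_le_sum fun l _ => ?_) (sum_sortedProb_sub (m + 1) p)
  refine mul_le_of_le_one_right
    (sub_nonneg.2 (sortedProb_succ_le _ _ _)) (max_le zero_le_one ?_)
  linarith [shuffleDensity_nonneg (m + 1) p k l]

/-- Both sides are the probability of `L < l` after `k` shuffles: with `i < l` coupons missing, `L ≥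
l` has conditional probability `sortedProb l / sortedProb i`, and `p ^ i * i!` is `1 / sortedProb
i`. -/
theorem sum_sortedProb_sub_mul_shuffleDensity (n p k : ℕ) [NeZero p] {l : ℕ} (hl : l ≤ n + 1) :
    ∑ i ∈ Finset.range l, (sortedProb n p i - sortedProb n p (i + 1)) * shuffleDensity n p k i =
      ∑ i ∈ Finset.range l, missingProb n k i -
        sortedProb n p l * ∑ i ∈ Finset.range l, missingProb n k i * ((p : ℝ) ^ i * i.factorial) := by
  have hp : (p : ℝ) ≠ 0 := Nat.cast_ne_zero.2 (NeZero.ne p)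
  induction l with
  | zero => simp
  | succ l ih =>
    have h1 : sortedProb n p l * ((p : ℝ) ^ l * l.factorial) = 1 := by
      rw [sortedProb, if_pos (by omega)]
      field_simp
    rw [Finset.sum_range_succ, ih (by omega), shuffleDensity, Finset.sum_range_succ,
      Finset.sum_range_succ]
    linear_combination missingProb n k l * h1

theorem shuffleDist_ge_sum {n : ℕ} (hn : 0 < n) (p k : ℕ) [NeZero p] {l : ℕ} (hl : l ≤ n) :
    1 - ∑ i ∈ Finset.range l, missingProb n k i - sortedProb n p l ≤ shuffleDist n p k := by
  obtain ⟨m, rfl⟩ : ∃ m, n = m + 1 := ⟨n - 1, by omega⟩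
  rw [shuffleDist_eq]
  have hu : ∀ i, 0 ≤ sortedProb (m + 1) p i - sortedProb (m + 1) p (i + 1) := fun i =>
    sub_nonneg.2 (sortedProb_succ_le _ _ _)
  have h1 : ∑ i ∈ Finset.range l, (sortedProb (m + 1) p i - sortedProb (m + 1) p (i + 1)) *
      (1 - shuffleDensity (m + 1) p k i) ≤ ∑ i ∈ Finset.range (m + 1 + 1),
      (sortedProb (m + 1) p i - sortedProb (m + 1) p (i + 1)) *
        max 0 (1 - shuffleDensity (m + 1) p k i) :=
    le_trans (Finset.sum_le_sum fun i _ => mul_le_mul_of_nonneg_left (le_max_right _ _) (hu i))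
      (Finset.sum_le_sum_of_subset_of_nonneg (Finset.range_subset_range.2 (by omega))
        fun i _ _ => mul_nonneg (hu i) (le_max_left _ _))
  refine le_trans ?_ h1
  simp only [mul_sub, mul_one, Finset.sum_sub_distrib (f := fun i =>
    sortedProb (m + 1) p i - sortedProb (m + 1) p (i + 1)),
    sum_sortedProb_sub_mul_shuffleDensity (m + 1) p k (show l ≤ m + 1 + 1 by omega)]
  rw [Finset.sum_range_sub', sortedProb_zero]
  have h2 : 0 ≤ sortedProb (m + 1) p l *
      ∑ i ∈ Finset.range l, missingProb (m + 1) k i * ((p : ℝ) ^ i * i.factorial) :=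
    mul_nonneg (by unfold sortedProb; positivity)
      (Finset.sum_nonneg fun i _ => mul_nonneg (missingProb_nonneg _ _ _) (by positivity))
  linarith

theorem sum_range_missingProb_le {n : ℕ} (hn : 0 < n) (k : ℕ) {l : ℕ} (hl : l ≤ n) :
    ∑ i ∈ Finset.range l, missingProb n k i ≤
      2 ^ l * Real.exp (-(n * (1 - 1 / (n : ℝ)) ^ k / 2)) := by
  have hn' : (0 : ℝ) < n := by exact_mod_cast hn
  have hr0 : 0 ≤ 1 - 1 / (n : ℝ) := by
    rw [sub_nonneg, div_le_one hn']; exact_mod_cast hn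
  have hr1 : (1 - 1 / (n : ℝ)) ^ k ≤ 1 :=
    pow_le_one₀ hr0 (by linarith [show 0 ≤ 1 / (n : ℝ) by positivity])
  -- Chernoff bound at `u = 1/2`: on `i < l` the weight `2 ^ l * u ^ i` is at least `1`.
  have h1 := sum_missingProb_mul_pow_le hn k (u := 1 / 2) (by norm_num) (by norm_num)
  have h2 : (1 - (1 - 1 / 2) * (1 - 1 / (n : ℝ)) ^ k) ^ n ≤
      Real.exp (-(n * (1 - 1 / (n : ℝ)) ^ k / 2)) := by
    have := Real.one_sub_le_exp_neg ((1 - 1 / 2) * (1 - 1 / (n : ℝ)) ^ k)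
    refine (pow_le_pow_left₀ (by linarith) this n).trans (le_of_eq ?_)
    rw [← Real.exp_nat_mul]
    congr 1
    ring
  have h3 : ∑ i ∈ Finset.range l, missingProb n k i ≤
      2 ^ l * ∑ i ∈ Finset.range (n + 1), missingProb n k i * (1 / 2) ^ i := by
    rw [Finset.mul_sum]
    refine le_trans (Finset.sum_le_sum fun i hi => ?_)
      (Finset.sum_le_sum_of_subset_of_nonneg (Finset.range_subset_range.2 (by omega))
        fun i _ _ => mul_nonneg (by positivity)
          (mul_nonneg (missingProb_nonneg _ _ _) (by positivity)))
    have h4 : (1 : ℝ) ≤ 2 ^ l * (1 / 2) ^ i := by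
      rw [one_div, inv_pow, ← div_eq_mul_inv, one_le_div (by positivity)]
      exact pow_le_pow_right₀ (by norm_num) (Finset.mem_range.1 hi).le
    calc missingProb n k i ≤ missingProb n k i * (2 ^ l * (1 / 2) ^ i) :=
          le_mul_of_one_le_right (missingProb_nonneg _ _ _) h4
      _ = _ := by ring
  exact h3.trans (mul_le_mul_of_nonneg_left (h1.trans h2) (by positivity))

/-- If the expected number of untouched cards is `M`, then the distance to uniformity is at least
`1 - O(exp (-M / 4))`. -/
theorem shuffleDist_ge {n : ℕ} (hn : 0 < n) (p k : ℕ) [NeZero p] :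
    1 - (1 + Real.exp (Real.exp 1 + 1)) * Real.exp (-(n * (1 - 1 / (n : ℝ)) ^ k / 4)) ≤
      shuffleDist n p k := by
  have hn' : (0 : ℝ) < n := by exact_mod_cast hn
  have hr0 : 0 ≤ 1 - 1 / (n : ℝ) := by
    rw [sub_nonneg, div_le_one hn']; exact_mod_cast hn
  have hr1 : (1 - 1 / (n : ℝ)) ^ k ≤ 1 :=
    pow_le_one₀ hr0 (by linarith [show 0 ≤ 1 / (n : ℝ) by positivity])
  have hMn : n * (1 - 1 / (n : ℝ)) ^ k ≤ n := mul_le_of_le_one_right hn'.le hr1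
  have hM0 : 0 ≤ n * (1 - 1 / (n : ℝ)) ^ k := mul_nonneg hn'.le (pow_nonneg hr0 k)
  have h1 := fun l hl => sum_range_missingProb_le hn k (l := l) hl
  generalize n * (1 - 1 / (n : ℝ)) ^ k = M at *
  -- With this `l`, `2 ^ l ≤ exp (M / 4)` uses up only half of the exponent `M / 2`.
  set l := ⌊M / 4⌋₊ with hl
  have hlM : (l : ℝ) ≤ M / 4 := Nat.floor_le (by linarith)
  have hMl : M / 4 < l + 1 := Nat.lt_floor_add_one _
  have hln : l ≤ n := by
    have : (l : ℝ) ≤ n := by linarith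
    exact_mod_cast this
  have h2 : (2 : ℝ) ^ l ≤ Real.exp (M / 4) := by
    have : (2 : ℝ) ≤ Real.exp 1 := by linarith [Real.add_one_le_exp 1]
    calc (2 : ℝ) ^ l ≤ Real.exp 1 ^ l := pow_le_pow_left₀ (by norm_num) this l
      _ = Real.exp l := by rw [← Real.exp_nat_mul, mul_one]
      _ ≤ _ := Real.exp_le_exp.2 hlM
  have h3 : ∑ i ∈ Finset.range l, missingProb n k i ≤ Real.exp (-(M / 4)) := by
    refine (h1 l hln).trans ((mul_le_mul_of_nonneg_right h2 (Real.exp_pos _).le).trans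
      (le_of_eq ?_))
    rw [← Real.exp_add]
    congr 1
    ring
  have h4 : sortedProb n p l ≤ Real.exp (Real.exp 1 + 1) * Real.exp (-(M / 4)) := by
    have hp : (1 : ℝ) ≤ (p : ℝ) ^ l :=
      one_le_pow₀ (by exact_mod_cast Nat.pos_of_ne_zero (NeZero.ne p))
    have hf : (0 : ℝ) < l.factorial := by positivity
    rw [sortedProb, if_pos hln, ← Real.exp_add]
    -- One term of the series of `exp e` gives `1 / l! ≤ exp e * exp (-l)`; the floor costs the
    -- further factor `e`.
    have h5 := Real.pow_div_factorial_le_exp (Real.exp 1) (Real.exp_pos 1).le l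
    rw [← Real.exp_nat_mul, mul_one, div_le_iff₀ hf] at h5
    rw [div_le_iff₀ (by positivity)]
    have h6 : Real.exp l ≤ Real.exp (Real.exp 1) * ((p : ℝ) ^ l * l.factorial) :=
      h5.trans (mul_le_mul_of_nonneg_left (le_mul_of_one_le_left hf.le hp) (Real.exp_pos _).le)
    have h7 : Real.exp (Real.exp 1 + 1 + -(M / 4)) =
        Real.exp (Real.exp 1) * Real.exp (1 - M / 4) := by
      rw [← Real.exp_add]; congr 1; ring
    have h8 : 1 ≤ Real.exp l * Real.exp (1 - M / 4) := by
      rw [← Real.exp_add]; exact Real.one_le_exp (by linarith)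
    rw [h7]
    nlinarith [Real.exp_pos (1 - M / 4)]
  have h9 := shuffleDist_ge_sum hn p k hln
  linarith

/-! ### Exponential estimates and the cutoff -/

theorem one_sub_div_pow_le_exp {m n : ℕ} (h : m ≤ n) (hn : 0 < n) (k : ℕ) :
    (1 - (m : ℝ) / n) ^ k ≤ Real.exp (-(m * (k / n))) := by
  have hn' : (0 : ℝ) < n := by exact_mod_cast hn
  have h1 : (m : ℝ) / n ≤ 1 := by rw [div_le_one hn']; exact_mod_cast h
  refine (pow_le_pow_left₀ (by linarith) (Real.one_sub_le_exp_neg _) k).trans (le_of_eq ?_)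
  rw [← Real.exp_nat_mul]
  congr 1
  ring

theorem exp_le_one_sub_div_pow {m n : ℕ} (h : m < n) (k : ℕ) :
    Real.exp (-(m * (k / ((n : ℝ) - m)))) ≤ (1 - (m : ℝ) / n) ^ k := by
  have hn' : (0 : ℝ) < n := by exact_mod_cast (Nat.zero_le m).trans_lt h
  have hmn : (0 : ℝ) < (n : ℝ) - m := sub_pos.2 (by exact_mod_cast h)
  have h1 : Real.exp (-(m / ((n : ℝ) - m))) ≤ 1 - (m : ℝ) / n := by
    have h2 := Real.add_one_le_exp ((m : ℝ) / (n - m))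
    have h3 : 1 - (m : ℝ) / n = ((m : ℝ) / (n - m) + 1)⁻¹ := by field_simp; ring
    rw [h3, Real.exp_neg]
    exact inv_anti₀ (by positivity) h2
  refine le_trans (le_of_eq ?_) (pow_le_pow_left₀ (Real.exp_pos _).le h1 k)
  rw [← Real.exp_nat_mul]
  congr 1
  ring

theorem exp_le_mul_one_sub_pow {n k : ℕ} (hn : 2 ≤ n) {y : ℝ} (hy : y ≤ Real.log n)
    (hk : k ≤ (n : ℝ) * y) :
    Real.exp (Real.log n - y - 1) ≤ n * (1 - 1 / (n : ℝ)) ^ k := by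
  have hn' : (2 : ℝ) ≤ n := by exact_mod_cast hn
  have h1 := exp_le_one_sub_div_pow (m := 1) (show 1 < n by omega) k
  rw [Nat.cast_one, one_mul] at h1
  -- The excess of `n y / (n - 1)` over `y` is `y / (n - 1) ≤ 1`, because `y ≤ log n ≤ n - 1`.
  have h2 : (k : ℝ) / (n - 1) ≤ y + 1 := by
    rw [div_le_iff₀ (by linarith)]
    have := Real.log_le_sub_one_of_pos (show (0 : ℝ) < n by linarith)
    nlinarith
  calc Real.exp (Real.log n - y - 1) = n * Real.exp (-(y + 1)) := by
        rw [show Real.log n - y - 1 = Real.log n + -(y + 1) by ring, Real.exp_add,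
          Real.exp_log (by linarith)]
    _ ≤ n * Real.exp (-(k / (n - 1))) := by gcongr
    _ ≤ _ := by gcongr

theorem tendsto_log_natCast : Tendsto (fun n : ℕ => Real.log n) atTop atTop :=
  Real.tendsto_log_atTop.comp tendsto_natCast_atTop_atTop

theorem shuffleDist_lower_bound (p : ℕ) [NeZero p] (c : ℕ → ℝ)
    (hc : ∀ᶠ n : ℕ in atTop, Real.log (Real.log ((n : ℝ) * (p : ℝ)) * Real.log (n : ℝ)) ≤ c n)
    (hc0 : Tendsto (fun n : ℕ => c n / Real.log (n : ℝ)) atTop (𝓝 0)) {δ : ℝ} (hδ : 0 < δ) :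
    ∃ C : ℝ, ∀ᶠ n : ℕ in atTop, 1 - C * (1 / (n : ℝ) ^ ((1 : ℝ) / 2 - δ)) ≤
      shuffleDist n p ⌊(n : ℝ) * Real.log (n : ℝ) - c n * (n : ℝ)⌋₊ := by
  refine ⟨1 + Real.exp (Real.exp 1 + 1), ?_⟩
  filter_upwards [hc, hc0.eventually_lt_const zero_lt_one, eventually_ge_atTop 2,
    tendsto_log_natCast.eventually_ge_atTop (2 * Real.exp 1)] with n h1 h2 hn h3
  have hn' : (2 : ℝ) ≤ n := by exact_mod_cast hn
  have hp : (1 : ℝ) ≤ p := by exact_mod_cast Nat.pos_of_ne_zero (NeZero.ne p)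
  have he := Real.add_one_le_exp 1
  have hlog : 0 < Real.log n := by linarith
  rw [div_lt_one hlog] at h2
  have h4 : Real.log n ≤ Real.log (n * p) :=
    Real.log_le_log (by linarith) (le_mul_of_one_le_right (by linarith) hp)
  have h5 : Real.log n * Real.log n ≤ Real.exp (c n) := by
    rw [← Real.exp_log (mul_pos hlog hlog)]
    refine Real.exp_le_exp.2 (le_trans (Real.log_le_log (mul_pos hlog hlog) ?_) h1)
    exact mul_le_mul_of_nonneg_right h4 hlog.le
  have hc1 : 0 ≤ c n := by
    refine le_trans (Real.log_nonneg ?_) h1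
    nlinarith
  have h6 := exp_le_mul_one_sub_pow (k := ⌊(n : ℝ) * Real.log (n : ℝ) - c n * (n : ℝ)⌋₊) hn
    (y := Real.log n - c n) (by linarith)
    ((Nat.floor_le (by nlinarith)).trans (le_of_eq (by ring)))
  -- The hypothesis on `c` gives `exp (c n) ≥ (log n)^2`, so `M ≥ (log n)^2 / e ≥ 2 log n` once `log
  -- n ≥ 2 e`. Then `exp (-M / 4)` is at most `n ^ (-1/2)`, already without the loss `δ`.
  have h7 : 2 * Real.log n ≤
      n * (1 - 1 / (n : ℝ)) ^ ⌊(n : ℝ) * Real.log (n : ℝ) - c n * (n : ℝ)⌋₊ := by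
    refine le_trans ?_ h6
    rw [show Real.log n - (Real.log n - c n) - 1 = c n - 1 by ring, Real.exp_sub,
      le_div_iff₀ (Real.exp_pos 1)]
    nlinarith
  refine le_trans ?_ (shuffleDist_ge (by omega) p _)
  have h8 : Real.exp (-(n * (1 - 1 / (n : ℝ)) ^ ⌊(n : ℝ) * Real.log (n : ℝ) - c n * (n : ℝ)⌋₊ / 4))
      ≤ 1 / (n : ℝ) ^ ((1 : ℝ) / 2 - δ) := by
    rw [one_div ((n : ℝ) ^ _), ← Real.rpow_neg (by linarith), Real.rpow_def_of_pos (by linarith)]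
    refine Real.exp_le_exp.2 ?_
    nlinarith
  have h9 := Real.exp_pos (Real.exp 1 + 1)
  nlinarith

theorem tendsto_shuffleDist_one (p : ℕ) [NeZero p] {a : ℝ} (ha : 0 < a) (ha1 : a < 1) :
    Tendsto (fun n : ℕ => shuffleDist n p ⌊a * ((n : ℝ) * Real.log (n : ℝ))⌋₊) atTop (𝓝 1) := by
  have hexp : Tendsto (fun n : ℕ => 1 - (1 + Real.exp (Real.exp 1 + 1)) *
      Real.exp (-(Real.exp ((1 - a) * Real.log n - 1) / 4))) atTop (𝓝 1) := by
    have h1 : Tendsto (fun n : ℕ => (1 - a) * Real.log n - 1) atTop atTop :=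
      tendsto_atTop_add_const_right _ _ (tendsto_log_natCast.const_mul_atTop (by linarith))
    have h2 : Tendsto (fun n : ℕ => Real.exp (-(Real.exp ((1 - a) * Real.log n - 1) / 4)))
        atTop (𝓝 0) :=
      Real.tendsto_exp_neg_atTop_nhds_zero.comp
        ((Real.tendsto_exp_atTop.comp h1).atTop_div_const (by norm_num))
    simpa using (h2.const_mul (1 + Real.exp (Real.exp 1 + 1))).const_sub 1
  refine tendsto_of_tendsto_of_tendsto_of_le_of_le' hexp tendsto_const_nhds ?_ ?_
  · filter_upwards [eventually_ge_atTop 2] with n hn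
    have hlog : 0 ≤ Real.log n := Real.log_natCast_nonneg n
    refine le_trans ?_ (shuffleDist_ge (by omega) p _)
    have h6 := exp_le_mul_one_sub_pow (k := ⌊a * ((n : ℝ) * Real.log (n : ℝ))⌋₊) hn
      (y := a * Real.log n) (by nlinarith)
      ((Nat.floor_le (by positivity)).trans (le_of_eq (by ring)))
    rw [show Real.log n - a * Real.log n - 1 = (1 - a) * Real.log n - 1 by ring] at h6
    gcongr
  · filter_upwards [eventually_gt_atTop 0] with n hn using shuffleDist_le_one hn p _

theorem tendsto_shuffleDist_zero (p : ℕ) [NeZero p] {a : ℝ} (ha : 1 < a) :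
    Tendsto (fun n : ℕ => shuffleDist n p ⌊a * ((n : ℝ) * Real.log (n : ℝ))⌋₊) atTop (𝓝 0) := by
  have hexp : Tendsto (fun n : ℕ => Real.exp (-((a - 1) * Real.log n - 1))) atTop (𝓝 0) :=
    Real.tendsto_exp_neg_atTop_nhds_zero.comp
      (tendsto_atTop_add_const_right _ _ (tendsto_log_natCast.const_mul_atTop (by linarith)))
  refine squeeze_zero' (Eventually.of_forall fun n => shuffleDist_nonneg n p _) ?_ hexp
  filter_upwards [eventually_gt_atTop 0] with n hn
  have hn' : (1 : ℝ) ≤ n := by exact_mod_cast hn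
  refine (shuffleDist_le hn p _).trans ?_
  have h1 := one_sub_div_pow_le_exp (m := 1) (show 1 ≤ n by omega) hn
    ⌊a * ((n : ℝ) * Real.log (n : ℝ))⌋₊
  rw [Nat.cast_one, one_mul] at h1
  have h2 : a * Real.log n - 1 ≤ (⌊a * ((n : ℝ) * Real.log (n : ℝ))⌋₊ : ℝ) / n := by
    rw [le_div_iff₀ (by linarith)]
    have := Nat.lt_floor_add_one (a * ((n : ℝ) * Real.log (n : ℝ)))
    linarith
  calc _ ≤ (n : ℝ) * Real.exp (-(⌊a * ((n : ℝ) * Real.log (n : ℝ))⌋₊ / n)) := by gcongr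
    _ ≤ n * Real.exp (-(a * Real.log n - 1)) := by gcongr
    _ = Real.exp (-((a - 1) * Real.log n - 1)) := by
      rw [show -((a - 1) * Real.log n - 1) = Real.log n + -(a * Real.log n - 1) by ring,
        Real.exp_add, Real.exp_log (by linarith)]

/-- Inclusion-exclusion over sets of `m` coupons avoided by all draws. In the induction, `i ↦
(-1)^(m+i) * choose m i` is an eigenvector of the chain with eigenvalue `1 - m/n`; at `k = 0` it is
an alternating binomial sum. -/
theorem missingProb_eq_sum {n : ℕ} (hn : 0 < n) (k i : ℕ) :
    missingProb n k i = ∑ m ∈ Finset.range (n + 1),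
      (-1) ^ (m + i) * (n.choose m : ℝ) * m.choose i * (1 - (m : ℝ) / n) ^ k := by
  have hn' : (n : ℝ) ≠ 0 := by positivity
  induction k generalizing i with
  | zero =>
    simp only [pow_zero, mul_one, missingProb]
    rcases lt_or_ge n i with h | h
    · rw [if_neg h.ne', Finset.sum_eq_zero]
      intro m hm
      have : m.choose i = 0 := Nat.choose_eq_zero_of_lt (by have := Finset.mem_range.1 hm; omega)
      simp [this]
    · rw [← Finset.sum_range_add_sum_Ico _ (show i ≤ n + 1 by omega), Finset.sum_eq_zero, zero_add,
        Finset.sum_Ico_eq_sum_range, show n + 1 - i = n - i + 1 by omega]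
      · have h1 : ∀ m ∈ Finset.range (n - i + 1),
            (-1 : ℝ) ^ (i + m + i) * (n.choose (i + m) : ℝ) * ((i + m).choose i : ℝ) =
              n.choose i * ((((-1) ^ m * ((n - i).choose m : ℤ) : ℤ)) : ℝ) := by
          intro m _
          have h2 := Nat.choose_mul (n := n) (k := i + m) (s := i) (by omega)
          rw [Nat.add_sub_cancel_left] at h2
          have h3 : (n.choose (i + m) : ℝ) * ((i + m).choose i : ℝ) =
              n.choose i * (n - i).choose m := by exact_mod_cast h2
          rw [mul_assoc, h3, show i + m + i = 2 * i + m by ring, pow_add, pow_mul]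
          push_cast
          ring
        rw [Finset.sum_congr rfl h1, ← Finset.mul_sum, ← Int.cast_sum,
          Int.alternating_sum_range_choose]
        rcases h.eq_or_lt with rfl | h
        · simp
        · rw [if_neg h.ne, if_neg (by omega)]
          simp
      · intro m hm
        simp [Nat.choose_eq_zero_of_lt (Finset.mem_range.1 hm)]
  | succ k ih =>
    rw [missingProb_succ, ih, ih, Finset.mul_sum, Finset.mul_sum, ← Finset.sum_add_distrib]
    refine Finset.sum_congr rfl fun m _ => ?_
    have h1 : ((m.choose (i + 1) : ℕ) : ℝ) * (i + 1) = m.choose i * (m - i) := by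
      rcases le_or_gt i m with h | h
      · rw [← Nat.cast_sub h]
        exact_mod_cast Nat.choose_succ_right_eq m i
      · simp [Nat.choose_eq_zero_of_lt h, Nat.choose_eq_zero_of_lt (Nat.lt_succ_of_lt h)]
    rw [show m + (i + 1) = m + i + 1 by ring, pow_succ (-1 : ℝ) (m + i), pow_succ _ k]
    have h2 : (1 - (i : ℝ) / n) * m.choose i - ((i : ℝ) + 1) / n * m.choose (i + 1) =
        m.choose i * (1 - (m : ℝ) / n) := by
      field_simp
      linear_combination -h1
    linear_combination ((-1) ^ (m + i) * (n.choose m : ℝ) * (1 - (m : ℝ) / n) ^ k) * h2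

/-! ### The Poisson limit at `n log n + c n` -/

section Limit

variable {k : ℕ → ℕ} {c : ℝ}

theorem tendsto_mul_exp_neg_div_sub (hk : Tendsto (fun n : ℕ => (k n : ℝ) / n - Real.log n) atTop
    (𝓝 c)) (m : ℕ) :
    Tendsto (fun n : ℕ => (n : ℝ) * Real.exp (-(k n / ((n : ℝ) - m)))) atTop
      (𝓝 (Real.exp (-c))) := by
  have hsub : Tendsto (fun n : ℕ => (n : ℝ) - m) atTop atTop :=
    tendsto_atTop_add_const_right _ _ tendsto_natCast_atTop_atTop
  have h1 : Tendsto (fun n : ℕ => (m : ℝ) / ((n : ℝ) - m)) atTop (𝓝 0) :=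
    hsub.const_div_atTop _
  have h2 : Tendsto (fun n : ℕ => Real.log n / ((n : ℝ) - m)) atTop (𝓝 0) := by
    have h3 : Tendsto (fun n : ℕ => Real.log n / (n : ℝ)) atTop (𝓝 0) :=
      Real.isLittleO_log_id_atTop.tendsto_div_nhds_zero.comp tendsto_natCast_atTop_atTop
    have h4 : Tendsto (fun n : ℕ => Real.log n / (n : ℝ) * (1 + (m : ℝ) / ((n : ℝ) - m))) atTop
        (𝓝 (0 * (1 + 0))) := h3.mul (h1.const_add 1)
    rw [zero_mul] at h4
    refine h4.congr' ?_
    filter_upwards [eventually_gt_atTop m] with n hn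
    have hn0 : (n : ℝ) ≠ 0 := Nat.cast_ne_zero.2 (by omega)
    have hnm : (n : ℝ) - m ≠ 0 := sub_ne_zero.2 (by exact_mod_cast hn.ne')
    field_simp
    ring
  have h5 : Tendsto (fun n : ℕ => (k n : ℝ) / ((n : ℝ) - m) - Real.log n) atTop (𝓝 c) := by
    have h6 := (hk.mul (h1.const_add 1)).add (h2.const_mul (m : ℝ))
    simp only [add_zero, mul_one, mul_zero] at h6
    refine h6.congr' ?_
    filter_upwards [eventually_gt_atTop m] with n hn
    have hn0 : (n : ℝ) ≠ 0 := Nat.cast_ne_zero.2 (by omega)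
    have hnm : (n : ℝ) - m ≠ 0 := sub_ne_zero.2 (by exact_mod_cast hn.ne')
    field_simp
    ring
  refine ((Real.continuous_exp.tendsto _).comp h5.neg).congr' ?_
  filter_upwards [eventually_gt_atTop 0] with n hn
  have hn0 : (0 : ℝ) < n := by exact_mod_cast hn
  rw [Function.comp_apply, neg_sub, sub_eq_add_neg, Real.exp_add, Real.exp_log hn0]

theorem tendsto_choose_mul_one_sub_pow
    (hk : Tendsto (fun n : ℕ => (k n : ℝ) / n - Real.log n) atTop (𝓝 c)) (m : ℕ) :
    Tendsto (fun n : ℕ => (n.choose m : ℝ) * (1 - (m : ℝ) / n) ^ k n) atTop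
      (𝓝 (Real.exp (-c) ^ m / m.factorial)) := by
  -- `(1 - m/n)^k` lies between `exp (-m k/(n - m))` and `exp (-m k/n)`; the shifts `m` and `0`
  -- treat the two bounds alike.
  have h1 := ProbabilityTheory.tendsto_choose_mul_pow_atTop m (tendsto_mul_exp_neg_div_sub hk m)
  have h2 := ProbabilityTheory.tendsto_choose_mul_pow_atTop m (tendsto_mul_exp_neg_div_sub hk 0)
  refine tendsto_of_tendsto_of_tendsto_of_le_of_le' h1 h2 ?_ ?_
  · filter_upwards [eventually_gt_atTop m] with n hn
    refine mul_le_mul_of_nonneg_left (le_trans (le_of_eq ?_) (exp_le_one_sub_div_pow hn (k n)))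
      (Nat.cast_nonneg _)
    rw [← Real.exp_nat_mul]
    congr 1
    ring
  · filter_upwards [eventually_gt_atTop m] with n hn
    refine mul_le_mul_of_nonneg_left ((one_sub_div_pow_le_exp hn.le (by omega) (k n)).trans
      (le_of_eq ?_)) (Nat.cast_nonneg _)
    rw [← Real.exp_nat_mul, Nat.cast_zero, sub_zero]
    congr 1
    ring

/-- Recovers the Poisson weights from the limiting binomial moments `x ^ m / m!`; after the shift `m
= j + i` it is the series of `exp (-x)`. -/
theorem hasSum_alternating_choose (x : ℝ) (i : ℕ) :
    HasSum (fun m : ℕ => (-1) ^ (m + i) * (m.choose i : ℝ) * (x ^ m / m.factorial))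
      (Real.exp (-x) * x ^ i / i.factorial) := by
  rw [← (add_left_injective i).hasSum_iff]
  · have h := (NormedSpace.expSeries_div_hasSum_exp (-x)).mul_right (x ^ i / i.factorial)
    rw [← Real.exp_eq_exp_ℝ, ← mul_div_assoc] at h
    refine (congrArg (HasSum · _) (funext fun j => ?_)).mpr h
    have h1 : ((j + i).choose i : ℝ) * j.factorial * i.factorial = (j + i).factorial := by
      exact_mod_cast Nat.add_choose_mul_factorial_mul_factorial j i
    have h2 : ((j + i).choose i : ℝ) ≠ 0 := by
      exact_mod_cast (Nat.choose_pos (Nat.le_add_left i j)).ne'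
    simp only [Function.comp_apply, ← h1, pow_add, neg_pow x]
    field_simp
    rw [← pow_mul, mul_comm i 2, pow_mul]
    simp
  · intro m hm
    have : m < i := by
      by_contra h
      exact hm ⟨m - i, Nat.sub_add_cancel (not_lt.1 h)⟩
    simp [Nat.choose_eq_zero_of_lt this]

theorem tendsto_missingProb
    (hk : Tendsto (fun n : ℕ => (k n : ℝ) / n - Real.log n) atTop (𝓝 c)) (i : ℕ) :
    Tendsto (fun n : ℕ => missingProb n (k n) i) atTop
      (𝓝 (Real.exp (-Real.exp (-c)) * Real.exp (-c) ^ i / i.factorial)) := by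
  have hterm : ∀ m : ℕ, Tendsto (fun n : ℕ =>
      (-1) ^ (m + i) * (n.choose m : ℝ) * m.choose i * (1 - (m : ℝ) / n) ^ k n) atTop
      (𝓝 ((-1) ^ (m + i) * (m.choose i : ℝ) * (Real.exp (-c) ^ m / m.factorial))) := by
    intro m
    refine ((tendsto_choose_mul_one_sub_pow hk m).const_mul
      ((-1) ^ (m + i) * (m.choose i : ℝ))).congr fun n => ?_
    ring
  have hbound : ∀ᶠ n : ℕ in atTop, ∀ m : ℕ,
      ‖(-1) ^ (m + i) * (n.choose m : ℝ) * m.choose i * (1 - (m : ℝ) / n) ^ k n‖ ≤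
        (2 * (Real.exp (-c) + 1)) ^ m / m.factorial := by
    have h0 := tendsto_mul_exp_neg_div_sub hk 0
    filter_upwards [eventually_gt_atTop 0,
      h0.eventually_le_const (show Real.exp (-c) < Real.exp (-c) + 1 by linarith)] with n hn h1
    intro m
    rcases lt_or_ge n m with h | h
    · rw [Nat.choose_eq_zero_of_lt h]
      simp only [Nat.cast_zero, mul_zero, zero_mul, norm_zero]
      positivity
    have hn' : (0 : ℝ) < n := by exact_mod_cast hn
    have h2 : 0 ≤ (1 - (m : ℝ) / n) ^ k n :=
      pow_nonneg (sub_nonneg.2 ((div_le_one hn').2 (by exact_mod_cast h))) _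
    have h3 : (m.choose i : ℝ) ≤ 2 ^ m := by exact_mod_cast Nat.choose_le_two_pow m i
    rw [norm_mul, norm_mul, norm_mul, norm_pow, norm_neg, norm_one, one_pow, one_mul,
      Real.norm_of_nonneg h2, Real.norm_natCast, Real.norm_natCast]
    calc (n.choose m : ℝ) * m.choose i * (1 - (m : ℝ) / n) ^ k n
        ≤ (n : ℝ) ^ m / m.factorial * 2 ^ m * Real.exp (-(m * (k n / n))) :=
          mul_le_mul (mul_le_mul (Nat.choose_le_pow_div m n) h3 (by positivity) (by positivity))
            (one_sub_div_pow_le_exp h hn (k n)) h2 (by positivity)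
      _ = (2 * (n * Real.exp (-(k n / ((n : ℝ) - (0 : ℕ)))))) ^ m / m.factorial := by
          rw [mul_pow, mul_pow, ← Real.exp_nat_mul, Nat.cast_zero, sub_zero, mul_neg]
          ring
      _ ≤ _ := by gcongr
  have hlim := tendsto_tsum_of_dominated_convergence
    (Real.summable_pow_div_factorial (2 * (Real.exp (-c) + 1))) hterm hbound
  rw [(hasSum_alternating_choose (Real.exp (-c)) i).tsum_eq] at hlim
  refine hlim.congr' ?_
  filter_upwards [eventually_gt_atTop 0] with n hn
  rw [missingProb_eq_sum hn, tsum_eq_sum]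
  intro m hm
  rw [Nat.choose_eq_zero_of_lt (by simpa using hm : n < m)]
  simp

/-- The limiting density at elements whose sorted tail has length `l`. -/
noncomputable def limitDensity (p : ℕ) (x : ℝ) (l : ℕ) : ℝ :=
  ∑ i ∈ Finset.range (l + 1), Real.exp (-x) * (p * x) ^ i

/-- The limiting uniform probability that the sorted tail has length `l`. -/
noncomputable def limitProb (p l : ℕ) : ℝ :=
  1 / ((p : ℝ) ^ l * l.factorial) - 1 / ((p : ℝ) ^ (l + 1) * (l + 1).factorial)

/-- The limiting distance, as a function of the expected number `x` of untouched cards. -/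
noncomputable def limitDist (p : ℕ) (x : ℝ) : ℝ :=
  ∑' l : ℕ, limitProb p l * max 0 (1 - limitDensity p x l)

theorem limitProb_nonneg (p : ℕ) [NeZero p] (l : ℕ) : 0 ≤ limitProb p l := by
  have := sortedProb_succ_le (l + 1) p l
  rw [sortedProb, sortedProb, if_pos le_rfl, if_pos (Nat.le_succ l)] at this
  exact sub_nonneg.2 this

theorem one_div_pow_mul_factorial_le (p : ℕ) [NeZero p] (l : ℕ) :
    1 / ((p : ℝ) ^ l * l.factorial) ≤ 1 ^ l / l.factorial := by
  have hp : (1 : ℝ) ≤ (p : ℝ) ^ l :=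
    one_le_pow₀ (by exact_mod_cast Nat.pos_of_ne_zero (NeZero.ne p))
  rw [one_pow]
  exact one_div_le_one_div_of_le (by positivity) (le_mul_of_one_le_left (by positivity) hp)

theorem hasSum_limitProb (p : ℕ) [NeZero p] : HasSum (limitProb p) 1 := by
  rw [(hasSum_iff_tendsto_nat_of_nonneg (limitProb_nonneg p) 1)]
  have h1 : ∀ n, ∑ i ∈ Finset.range n, limitProb p i = 1 - 1 / ((p : ℝ) ^ n * n.factorial) := by
    intro n
    simp only [limitProb]
    rw [Finset.sum_range_sub' fun i => 1 / ((p : ℝ) ^ i * i.factorial)]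
    simp
  simp only [h1]
  have h2 : Tendsto (fun n : ℕ => 1 / ((p : ℝ) ^ n * n.factorial)) atTop (𝓝 0) :=
    squeeze_zero (fun n => by positivity) (one_div_pow_mul_factorial_le p)
      (Real.summable_pow_div_factorial 1).tendsto_atTop_zero
  simpa using h2.const_sub 1

theorem limitDensity_nonneg (p l : ℕ) {x : ℝ} (hx : 0 ≤ x) : 0 ≤ limitDensity p x l :=
  Finset.sum_nonneg fun i _ => by positivity

theorem summable_limitDist (p : ℕ) [NeZero p] {x : ℝ} (hx : 0 ≤ x) :
    Summable fun l => limitProb p l * max 0 (1 - limitDensity p x l) :=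
  Summable.of_nonneg_of_le (fun l => mul_nonneg (limitProb_nonneg p l) (le_max_left _ _))
    (fun l => mul_le_of_le_one_right (limitProb_nonneg p l)
      (max_le zero_le_one (by linarith [limitDensity_nonneg p l hx])))
    (hasSum_limitProb p).summable

theorem limitDist_le (p : ℕ) [NeZero p] {x : ℝ} (hx : 0 ≤ x) : limitDist p x ≤ x := by
  have h1 := Real.one_sub_le_exp_neg x
  have h2 := (hasSum_limitProb p).mul_right x
  rw [one_mul] at h2
  refine hasSum_le (fun l => mul_le_mul_of_nonneg_left (max_le hx ?_) (limitProb_nonneg p l))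
    (summable_limitDist p hx).hasSum h2
  have h3 : Real.exp (-x) ≤ limitDensity p x l := by
    rw [limitDensity, Finset.sum_range_succ']
    simp only [pow_zero, mul_one, le_add_iff_nonneg_left]
    positivity
  linarith

theorem limitDist_pos (p : ℕ) [NeZero p] {x : ℝ} (hx : 0 < x) : 0 < limitDist p x := by
  have hnn : ∀ l, 0 ≤ limitProb p l * max 0 (1 - limitDensity p x l) := fun l =>
    mul_nonneg (limitProb_nonneg p l) (le_max_left _ _)
  have key : ∀ l, 0 < limitProb p l → limitDensity p x l < 1 → 0 < limitDist p x := by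
    intro l h1 h2
    exact (summable_limitDist p hx.le).tsum_pos hnn l
      (mul_pos h1 (lt_max_of_lt_right (by linarith)))
  -- Without colors a tail of length one is always sorted, so `l = 0` has limiting weight zero and
  -- `l = 1` is needed, with `exp (-x) (1 + x) < 1`. For `p ≥ 2`, `l = 0` suffices.
  rcases (Nat.one_le_iff_ne_zero.2 (NeZero.ne p)).eq_or_lt with rfl | hp
  · refine key 1 (by norm_num [limitProb, Nat.factorial]) ?_
    have h1 := Real.add_one_lt_exp hx.ne'
    rw [limitDensity, Finset.sum_range_succ, Finset.sum_range_one, ← mul_add, Real.exp_neg,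
      inv_mul_lt_iff₀ (Real.exp_pos x)]
    simpa [add_comm] using h1
  · refine key 0 ?_ (by simpa [limitDensity] using hx)
    have hp' : (1 : ℝ) < p := by exact_mod_cast hp
    simp [limitProb]
    exact inv_lt_one_of_one_lt₀ hp'

theorem tendsto_shuffleDist_limitDist (p : ℕ) [NeZero p]
    (hk : Tendsto (fun n : ℕ => (k n : ℝ) / n - Real.log n) atTop (𝓝 c)) :
    Tendsto (fun n : ℕ => shuffleDist n p (k n)) atTop (𝓝 (limitDist p (Real.exp (-c)))) := by
  have hdens : ∀ l, Tendsto (fun n : ℕ => shuffleDensity n p (k n) l) atTop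
      (𝓝 (limitDensity p (Real.exp (-c)) l)) := by
    intro l
    refine tendsto_finsetSum _ fun i _ => ?_
    have h := (tendsto_missingProb hk i).mul_const ((p : ℝ) ^ i * i.factorial)
    rwa [show Real.exp (-Real.exp (-c)) * Real.exp (-c) ^ i / i.factorial *
      ((p : ℝ) ^ i * i.factorial) = Real.exp (-Real.exp (-c)) * (p * Real.exp (-c)) ^ i by
        rw [mul_pow]; field_simp] at h
  have hprob : ∀ l, Tendsto (fun n : ℕ => sortedProb n p l - sortedProb n p (l + 1)) atTop
      (𝓝 (limitProb p l)) := by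
    intro l
    refine tendsto_const_nhds.congr' ?_
    filter_upwards [eventually_ge_atTop (l + 1)] with n hn
    rw [sortedProb, sortedProb, if_pos hn, if_pos (by omega), limitProb]
  have hterm : ∀ l, Tendsto (fun n : ℕ => (sortedProb n p l - sortedProb n p (l + 1)) *
      max 0 (1 - shuffleDensity n p (k n) l)) atTop
      (𝓝 (limitProb p l * max 0 (1 - limitDensity p (Real.exp (-c)) l))) := fun l =>
    (hprob l).mul (tendsto_const_nhds.max ((hdens l).const_sub 1))
  -- The `l`-th term is at most `sortedProb n p l ≤ 1 / l!`, uniformly in `n`.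
  have hlim := tendsto_tsum_of_dominated_convergence (Real.summable_pow_div_factorial 1) hterm
    (Eventually.of_forall fun n l => by
      have h1 : 0 ≤ sortedProb n p (l + 1) := by unfold sortedProb; positivity
      have h2 : sortedProb n p l ≤ 1 ^ l / l.factorial := by
        rw [sortedProb]
        split_ifs
        · exact one_div_pow_mul_factorial_le p l
        · positivity
      have h3 := sub_nonneg.2 (sortedProb_succ_le n p l)
      have h4 : max 0 (1 - shuffleDensity n p (k n) l) ≤ 1 :=
        max_le zero_le_one (by linarith [shuffleDensity_nonneg n p (k n) l])
      rw [Real.norm_of_nonneg (mul_nonneg h3 (le_max_left _ _))]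
      exact (mul_le_of_le_one_right h3 h4).trans (by linarith))
  refine hlim.congr' ?_
  filter_upwards [eventually_gt_atTop 0] with n hn
  obtain ⟨m, rfl⟩ : ∃ m, n = m + 1 := ⟨n - 1, by omega⟩
  rw [shuffleDist_eq, tsum_eq_sum]
  intro l hl
  have hl : m + 1 < l := by simpa using hl
  rw [sortedProb, sortedProb, if_neg (by omega), if_neg (by omega), sub_zero, zero_mul]

end Limit

theorem tendsto_floor_div_sub_log {c : ℝ} (hc : 0 < c) :
    Tendsto (fun n : ℕ => (⌊(n : ℝ) * Real.log (n : ℝ) + c * (n : ℝ)⌋₊ : ℝ) / n - Real.log n)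
      atTop (𝓝 c) := by
  have h1 : Tendsto (fun n : ℕ => c - 1 / (n : ℝ)) atTop (𝓝 c) := by
    simpa using (tendsto_one_div_atTop_nhds_zero_nat (𝕜 := ℝ)).const_sub c
  refine tendsto_of_tendsto_of_tendsto_of_le_of_le' h1 tendsto_const_nhds ?_ ?_
  · filter_upwards [eventually_gt_atTop 0] with n hn
    have hn' : (0 : ℝ) < n := by exact_mod_cast hn
    have := Nat.lt_floor_add_one ((n : ℝ) * Real.log (n : ℝ) + c * (n : ℝ))
    rw [le_sub_iff_add_le, le_div_iff₀ hn']
    have h2 : 1 / (n : ℝ) * n = 1 := by field_simp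
    linarith
  · filter_upwards [eventually_gt_atTop 0] with n hn
    have hn' : (0 : ℝ) < n := by exact_mod_cast hn
    have hlog : 0 ≤ Real.log n := Real.log_natCast_nonneg n
    have := Nat.floor_le (show 0 ≤ (n : ℝ) * Real.log (n : ℝ) + c * (n : ℝ) by positivity)
    rw [sub_le_iff_le_add, div_le_iff₀ hn']
    linarith

theorem mainTheorem2 (p : ℕ) [NeZero p] :
    (∃ f : ℝ → ℝ,
      (∀ c : ℝ, 0 < c →
        0 < f c ∧
        Tendsto
          (fun n : ℕ => shuffleDist n p ⌊(n : ℝ) * Real.log (n : ℝ) + c * (n : ℝ)⌋₊)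
          atTop (𝓝 (f c))) ∧
      (∃ C : ℝ, ∀ᶠ c : ℝ in atTop, f c ≤ Real.exp (-c) + C * Real.exp (-2 * c))) ∧
    (∀ c : ℕ → ℝ,
      (∀ᶠ n : ℕ in atTop,
        Real.log (Real.log ((n : ℝ) * (p : ℝ)) * Real.log (n : ℝ)) ≤ c n) →
      Tendsto (fun n : ℕ => c n / Real.log (n : ℝ)) atTop (𝓝 0) →
      ∀ δ : ℝ, 0 < δ →
        ∃ C : ℝ, ∀ᶠ n : ℕ in atTop,
          1 - C * (1 / (n : ℝ) ^ ((1 : ℝ) / 2 - δ)) ≤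
            shuffleDist n p ⌊(n : ℝ) * Real.log (n : ℝ) - c n * (n : ℝ)⌋₊) ∧
    (∀ a : ℝ, 0 < a → a < 1 →
      Tendsto (fun n : ℕ => shuffleDist n p ⌊a * ((n : ℝ) * Real.log (n : ℝ))⌋₊)
        atTop (𝓝 1)) ∧
    (∀ a : ℝ, 1 < a →
      Tendsto (fun n : ℕ => shuffleDist n p ⌊a * ((n : ℝ) * Real.log (n : ℝ))⌋₊)
        atTop (𝓝 0)) := by
  -- The constant is `C = 0`: the bound `f(c) ≤ exp (-c)` holds without an error term.
  refine ⟨⟨fun c => limitDist p (Real.exp (-c)), fun c hc => ⟨limitDist_pos p (Real.exp_pos _),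
    tendsto_shuffleDist_limitDist p (tendsto_floor_div_sub_log hc)⟩, 0, Eventually.of_forall
    fun c => ?_⟩, fun c hc hc0 δ hδ => shuffleDist_lower_bound p c hc hc0 hδ,
    fun a ha ha1 => tendsto_shuffleDist_one p ha ha1, fun a ha => tendsto_shuffleDist_zero p ha⟩
  simpa using limitDist_le p (Real.exp_pos (-c)).le
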